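/- **Language.** Finite types are generated from $0$ by $(\sigma,\tau)\mapsto(\sigma\to\tau)$; write $1=0\to0$ and $n+1=n\to0$. The language $\mathsf L_\omega$ is many-sorted with variables of every finite type, constants $0,1,+,\times$ for arithmetic, combinators $\Pi_{\sigma,\tau},\Sigma_{\rho,\sigma,\tau}$ and recursors $\mathbf R_\sigma$ of type $(\sigma\to\sigma)\to\sigma\to0\to\sigma$, and relation symbols $=_0,<_0$ on type $0$. Equality $s=_\tau t$ at higher types abbreviates $(\forall z_1\dots z_k)(sz_1\cdots z_k=_0tz_1\cdots z_k)$. Write $x\le_0y$ for $x<_0y\vee x=_0y$, and extend $\le$ pointwise to higher types. The logic is classical. **Systems.** $\mathsf{RCA}_0^\omega$ has the following axioms: (a) the basic axioms saying that $=_0$ is an equality relation respected by $<_0$, and that $0,1,<_0,+,\times$ form a discretely ordered commutative semiring with least element $0$; (b) $\Pi xy=x$ and $\Sigma xyz=xz(yz)$; (c) $\mathbf R_0(f,m,0)=m$ and $\mathbf R_0(f,m,n+1)=f(\mathbf R_0(f,m,n))$ for $f^1$, $m^0$, $n^0$; (d) extensionality $(\forall x^\rho,y^\rho,\varphi^{\rho\to\tau})(x=_\rho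 y\to\varphi(x)=_\tau\varphi(y))$ for all $\rho,\tau$; (e) induction for all quantifier-free formulas; (f) $\mathsf{QF\text{-}AC}^{1,0}$. Here $\mathsf{QF\text{-}AC}^{\sigma,\tau}$ is the schema $$(\forall x^\sigma)(\exists y^\tau)A(x,y)\to(\exists Y^{\sigma\to\tau})(\forall x^\sigma)A(x,Y(x))$$ for all quantifier-free $A$. In (e) and (f), parameters of all finite types are allowed. **Principles.** Write $f\in C$ for $f^1\le_1 1$, and $\overline fN=\overline gN$ for $(\forall i<N)(f(i)=g(i))$. For $Y^2$, let $Y\in\mathsf{cont}$ stand for $(\forall f^1)(\exists N^0)(\forall g^1)(\overline fN=\overline gN\to Y(f)=Y(g))$. - $(\exists^2)$: $(\exists\varphi^2\le_21)(\forall f^1)[(\exists n^0)(f(n)=0)\leftrightarrow\varphi(f)=0]$. - $(\exists^3)$: $(\exists E^3\le_31)(\forall Y^2)[(\exists f^1)(Y(f)=0)\leftrightarrow E(Y)=0]$. - $(\kappa_0^3)$: $(\exists\kappa^3)(\forall Y^2)[\kappa(Y)=0\leftrightarrow(\exists f\in C)(Y(f)>0)]$. - $(Z^3)$: $(\exists Z^3)(\forall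 Y^2)[Z(Y)=0\leftrightarrow Y\in\mathsf{cont}]$. - $\mathsf{FF}$: $(\exists\Phi^3)(\forall Y^2\in\mathsf{cont})(\forall f,g\in C)(\overline f\Phi(Y)=\overline g\Phi(Y)\to Y(f)=Y(g))$. - $\mathsf{WKL}$: every infinite binary tree has a path. Here binary sequences are coded bijectively by numbers ($\langle\rangle\mapsto0$, and if $\sigma\mapsto c$ then $\sigma*\langle i\rangle\mapsto2c+1+i$ for $i\in\{0,1\}$), and a tree is given by $T^1$ as the set of those $\sigma$ with $T(\sigma)=0$, which must be closed under initial segments; a path is an $f\in C$ all of whose finite initial segments are in the tree. **Corollary.** 1. $\mathsf{RCA}_0^\omega+\mathsf{QF\text{-}AC}^{2,0}$ proves $[(\kappa_0^3)\wedge\mathsf{WKL}]\leftrightarrow[(Z^3)\wedge\mathsf{FF}]$. 2. $\mathsf{RCA}_0^\omega$ proves $(\exists^3)\leftrightarrow[(\exists^2)\wedge(Z^3)]$. -/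

import Mathlib

/-! The language of higher-order arithmetic in all finite types (intrinsically typed, with de Bruijn
variables), classical natural deduction for it, the base theory `RCA₀^ω`, the schema `QF-AC^{σ,τ}`,
and the sentences `(∃²)`, `(∃³)`, `(κ₀³)`, `(Z³)`, `FF`, `WKL`. -/

namespace HOA

/-- The finite types: `0` (here `nat`), and `σ → τ` (here `arr σ τ`). -/
inductive Ty : Type
  | nat : Ty
  | arr : Ty → Ty → Ty

/-- Type `1`. -/
abbrev T1 : Ty := Ty.arr Ty.nat Ty.nat
/-- Type `2`. -/
abbrev T2 : Ty := Ty.arr T1 Ty.nat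
/-- Type `3`. -/
abbrev T3 : Ty := Ty.arr T2 Ty.nat

/-- A context: the types of the free variables, the most recently bound one first. -/
abbrev Ctx : Type := List Ty

/-- The variables of type `σ` in a context (typed de Bruijn indices). -/
inductive Var : Ctx → Ty → Type
  | here {Γ : Ctx} {σ : Ty} : Var (σ :: Γ) σ
  | there {Γ : Ctx} {σ τ : Ty} : Var Γ σ → Var (τ :: Γ) σ

/-- The constants: `0`, `1`, `+`, `×`, the combinators `Π` (`K`) and `Σ` (`S`), and
the recursors `R_σ`. -/
inductive Const : Ty → Type
  | zero : Const Ty.nat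
  | one : Const Ty.nat
  | add : Const (Ty.arr Ty.nat (Ty.arr Ty.nat Ty.nat))
  | mul : Const (Ty.arr Ty.nat (Ty.arr Ty.nat Ty.nat))
  | K (σ τ : Ty) : Const (Ty.arr σ (Ty.arr τ σ))
  | S (ρ σ τ : Ty) :
      Const (Ty.arr (Ty.arr ρ (Ty.arr σ τ)) (Ty.arr (Ty.arr ρ σ) (Ty.arr ρ τ)))
  | R (σ : Ty) : Const (Ty.arr (Ty.arr σ σ) (Ty.arr σ (Ty.arr Ty.nat σ)))

/-- Terms, indexed by their context and their type. -/
inductive Term : Ctx → Ty → Type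
  | var {Γ : Ctx} {σ : Ty} : Var Γ σ → Term Γ σ
  | const {Γ : Ctx} {σ : Ty} : Const σ → Term Γ σ
  | app {Γ : Ctx} {σ τ : Ty} : Term Γ (Ty.arr σ τ) → Term Γ σ → Term Γ τ

/-- Formulas. The relation symbols are `=₀` and `<₀`. The logic is classical, so falsity, implication
and the universal quantifiers suffice as primitives; the others are defined below. -/
inductive Formula : Ctx → Type
  | eq {Γ : Ctx} : Term Γ Ty.nat → Term Γ Ty.nat → Formula Γ
  | lt {Γ : Ctx} : Term Γ Ty.nat → Term Γ Ty.nat → Formula Γ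
  | falsum {Γ : Ctx} : Formula Γ
  | imp {Γ : Ctx} : Formula Γ → Formula Γ → Formula Γ
  | all {Γ : Ctx} (σ : Ty) : Formula (σ :: Γ) → Formula Γ

abbrev Sentence : Type := Formula []

/-! ### Substitution -/

/-- Simultaneous substitutions: a term over `Δ` for each variable of `Γ`. -/
abbrev Sub (Γ Δ : Ctx) : Type := ∀ σ : Ty, Var Γ σ → Term Δ σ

def Term.subst {Γ Δ : Ctx} (s : Sub Γ Δ) : {σ : Ty} → Term Γ σ → Term Δ σ
  | _, .var v => s _ v
  | _, .const c => .const c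
  | _, .app t u => .app (t.subst s) (u.subst s)

/-- The substitution that views every variable of `Γ` as a variable of `τ :: Γ`. -/
def Sub.shift (Γ : Ctx) (τ : Ty) : Sub Γ (τ :: Γ) := fun _ v => .var (.there v)

/-- Weakening of a term by one new variable. -/
def Term.wk {Γ : Ctx} {σ τ : Ty} (t : Term Γ σ) : Term (τ :: Γ) σ := t.subst (Sub.shift Γ τ)

/-- A substitution, extended by a value for one more variable. -/
def Sub.cons {Γ Δ : Ctx} {τ : Ty} (t : Term Δ τ) (s : Sub Γ Δ) : Sub (τ :: Γ) Δ
  | _, .here => t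
  | _, .there v => s _ v

/-- A substitution, carried under a binder. -/
def Sub.lift {Γ Δ : Ctx} (τ : Ty) (s : Sub Γ Δ) : Sub (τ :: Γ) (τ :: Δ) :=
  Sub.cons (.var .here) (fun σ v => (s σ v).wk)

def Formula.subst : {Γ Δ : Ctx} → Sub Γ Δ → Formula Γ → Formula Δ
  | _, _, s, .eq t u => .eq (t.subst s) (u.subst s)
  | _, _, s, .lt t u => .lt (t.subst s) (u.subst s)
  | _, _, _, .falsum => .falsum
  | _, _, s, .imp A B => .imp (A.subst s) (B.subst s)
  | _, _, s, .all σ A => .all σ (A.subst (s.lift σ))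

/-- Weakening of a formula by one new variable. -/
def Formula.wk {Γ : Ctx} {τ : Ty} (A : Formula Γ) : Formula (τ :: Γ) := A.subst (Sub.shift Γ τ)

/-- `A[t]`: the term `t` for the last variable of `A`. -/
def Formula.inst {Γ : Ctx} {τ : Ty} (A : Formula (τ :: Γ)) (t : Term Γ τ) : Formula Γ :=
  A.subst (Sub.cons t (fun _ v => .var v))

/-! ### Defined connectives and notation -/

def Formula.neg {Γ : Ctx} (A : Formula Γ) : Formula Γ := .imp A .falsum
def Formula.or {Γ : Ctx} (A B : Formula Γ) : Formula Γ := .imp A.neg B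
def Formula.and {Γ : Ctx} (A B : Formula Γ) : Formula Γ := (Formula.imp A B.neg).neg
def Formula.iff {Γ : Ctx} (A B : Formula Γ) : Formula Γ := (Formula.imp A B).and (Formula.imp B A)
def Formula.ex {Γ : Ctx} (σ : Ty) (A : Formula (σ :: Γ)) : Formula Γ := (Formula.all σ A.neg).neg

def Term.zero {Γ : Ctx} : Term Γ Ty.nat := .const .zero
def Term.one {Γ : Ctx} : Term Γ Ty.nat := .const .one
def Term.add {Γ : Ctx} (s t : Term Γ Ty.nat) : Term Γ Ty.nat := .app (.app (.const .add) s) t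
def Term.mul {Γ : Ctx} (s t : Term Γ Ty.nat) : Term Γ Ty.nat := .app (.app (.const .mul) s) t

/-- `s ≤₀ t`. -/
def Formula.le {Γ : Ctx} (s t : Term Γ Ty.nat) : Formula Γ := (Formula.lt s t).or (Formula.eq s t)

infixl:100 " ⬩ " => Term.app
infixl:80 " +ₒ " => Term.add
infixl:85 " *ₒ " => Term.mul
infix:70 " =ₒ " => Formula.eq
infix:70 " <ₒ " => Formula.lt
infix:70 " ≤ₒ " => Formula.le
prefix:68 "¬ₒ " => Formula.neg
infixr:65 " ∧ₒ " => Formula.and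
infixr:64 " ∨ₒ " => Formula.or
infixr:60 " →ₒ " => Formula.imp
infix:58 " ↔ₒ " => Formula.iff

/-- `x0`, `x1`, … : the variables, counted from the innermost binder outwards. -/
abbrev x0 {Γ : Ctx} {a : Ty} : Term (a :: Γ) a := .var .here
abbrev x1 {Γ : Ctx} {a b : Ty} : Term (b :: a :: Γ) a := .var (.there .here)
abbrev x2 {Γ : Ctx} {a b c : Ty} : Term (c :: b :: a :: Γ) a := .var (.there (.there .here))
abbrev x3 {Γ : Ctx} {a b c d : Ty} : Term (d :: c :: b :: a :: Γ) a :=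
  .var (.there (.there (.there .here)))

/-- The universal closure of a formula. -/
def Formula.close : {Γ : Ctx} → Formula Γ → Sentence
  | [], A => A
  | σ :: _, A => Formula.close (.all σ A)

/-- Equality `s =_τ t` at an arbitrary type, defined pointwise from `=₀`. -/
def Formula.eqAt : {Γ : Ctx} → (τ : Ty) → Term Γ τ → Term Γ τ → Formula Γ
  | _, .nat, s, t => s =ₒ t
  | _, .arr σ τ, s, t => .all σ (Formula.eqAt τ (s.wk ⬩ x0) (t.wk ⬩ x0))

/-- Quantifier-free formulas (variables of any type may occur in them). -/
def Formula.IsQF : {Γ : Ctx} → Formula Γ → Prop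
  | _, .eq _ _ => True
  | _, .lt _ _ => True
  | _, .falsum => True
  | _, .imp A B => A.IsQF ∧ B.IsQF
  | _, .all _ _ => False

/-! ### Provability -/

/-- Classical natural deduction: `Deriv H A` says that `A` has a derivation from
hypotheses in `H`. -/
inductive Deriv : {Γ : Ctx} → Set (Formula Γ) → Formula Γ → Prop
  | hyp {Γ : Ctx} {H : Set (Formula Γ)} {A : Formula Γ} : A ∈ H → Deriv H A
  | impI {Γ : Ctx} {H : Set (Formula Γ)} {A B : Formula Γ} :
      Deriv (insert A H) B → Deriv H (A →ₒ B)
  | impE {Γ : Ctx} {H : Set (Formula Γ)} {A B : Formula Γ} :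
      Deriv H (A →ₒ B) → Deriv H A → Deriv H B
  | raa {Γ : Ctx} {H : Set (Formula Γ)} {A : Formula Γ} :
      Deriv (insert (¬ₒ A) H) .falsum → Deriv H A
  | allI {Γ : Ctx} {H : Set (Formula Γ)} {σ : Ty} {A : Formula (σ :: Γ)} :
      Deriv (Formula.wk '' H) A → Deriv H (.all σ A)
  | allE {Γ : Ctx} {H : Set (Formula Γ)} {σ : Ty} {A : Formula (σ :: Γ)} (t : Term Γ σ) :
      Deriv H (.all σ A) → Deriv H (A.inst t)

/-- The theory `T` proves the sentence `A`. -/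
def Proves (T : Set Sentence) (A : Sentence) : Prop := Deriv T A

/-! ### The base theory -/

/-- The matrices of the basic arithmetical laws, in three number variables `x2`, `x1`, `x0`:
`=₀` is an equality, and `0, 1, <₀, +₀, ×₀` form a discretely ordered commutative semiring
with least element `0`. (Compatibility of functions with `=₀` is part of extensionality.) -/
inductive BasicLaw : Formula [Ty.nat, Ty.nat, Ty.nat] → Prop
  | eq_refl : BasicLaw (x0 =ₒ x0)
  | eq_symm : BasicLaw (x0 =ₒ x1 →ₒ x1 =ₒ x0)
  | eq_trans : BasicLaw (x0 =ₒ x1 →ₒ x1 =ₒ x2 →ₒ x0 =ₒ x2)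
  | lt_congr_left : BasicLaw (x0 =ₒ x1 →ₒ x0 <ₒ x2 →ₒ x1 <ₒ x2)
  | lt_congr_right : BasicLaw (x0 =ₒ x1 →ₒ x2 <ₒ x0 →ₒ x2 <ₒ x1)
  | add_assoc : BasicLaw ((x0 +ₒ x1) +ₒ x2 =ₒ x0 +ₒ (x1 +ₒ x2))
  | add_comm : BasicLaw (x0 +ₒ x1 =ₒ x1 +ₒ x0)
  | add_zero : BasicLaw (x0 +ₒ .zero =ₒ x0)
  | mul_assoc : BasicLaw ((x0 *ₒ x1) *ₒ x2 =ₒ x0 *ₒ (x1 *ₒ x2))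
  | mul_comm : BasicLaw (x0 *ₒ x1 =ₒ x1 *ₒ x0)
  | mul_one : BasicLaw (x0 *ₒ .one =ₒ x0)
  | mul_zero : BasicLaw (x0 *ₒ .zero =ₒ .zero)
  | mul_add : BasicLaw (x0 *ₒ (x1 +ₒ x2) =ₒ x0 *ₒ x1 +ₒ x0 *ₒ x2)
  | lt_irrefl : BasicLaw (¬ₒ (x0 <ₒ x0))
  | lt_trans : BasicLaw (x0 <ₒ x1 →ₒ x1 <ₒ x2 →ₒ x0 <ₒ x2)
  | lt_total : BasicLaw (x0 <ₒ x1 ∨ₒ x0 =ₒ x1 ∨ₒ x1 <ₒ x0)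
  | add_lt_add : BasicLaw (x0 <ₒ x1 →ₒ x0 +ₒ x2 <ₒ x1 +ₒ x2)
  | mul_lt_mul : BasicLaw (.zero <ₒ x2 →ₒ x0 <ₒ x1 →ₒ x0 *ₒ x2 <ₒ x1 *ₒ x2)
  | not_lt_zero : BasicLaw (¬ₒ (x0 <ₒ .zero))
  | lt_succ : BasicLaw (x0 <ₒ x1 +ₒ .one ↔ₒ x0 <ₒ x1 ∨ₒ x0 =ₒ x1)

/-- Induction for `A`, in the last variable of `A`. -/
def inductionFor {Γ : Ctx} (A : Formula (Ty.nat :: Γ)) : Formula Γ :=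
  (A.inst .zero ∧ₒ
    .all Ty.nat (A →ₒ A.subst (Sub.cons (x0 +ₒ .one) (fun _ v => .var (.there v))))) →ₒ
  .all Ty.nat A

/-- Choice for `A(x, y)`, where `x` of type `σ` is the last variable of `A` but one, and `y` of type
`τ` the last: `(∀x)(∃y)A(x, y) → (∃Y)(∀x)A(x, Y(x))`. -/
def choiceFor {Γ : Ctx} {σ τ : Ty} (A : Formula (τ :: σ :: Γ)) : Formula Γ :=
  .all σ (.ex τ A) →ₒ
  .ex (Ty.arr σ τ) (.all σ
    (A.subst (Sub.cons (x1 ⬩ x0) (Sub.cons x0 (fun _ v => .var (.there (.there v)))))))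

/-- The schema `QF-AC^{σ,τ}`, with parameters of arbitrary types. -/
def QFAC (σ τ : Ty) : Set Sentence :=
  {B | ∃ (Γ : Ctx) (A : Formula (τ :: σ :: Γ)), A.IsQF ∧ B = (choiceFor A).close}

/-- The axioms of `RCA₀^ω` other than choice: basic laws, combinators, the recursor `R₀`,
extensionality, and quantifier-free induction. -/
inductive BaseLaw : Sentence → Prop
  | basic (A : Formula [Ty.nat, Ty.nat, Ty.nat]) : BasicLaw A → BaseLaw A.close
  | combK (σ τ : Ty) :
      BaseLaw (.all σ (.all τ (.eqAt σ (.const (.K σ τ) ⬩ x1 ⬩ x0) x1)))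
  | combS (ρ σ τ : Ty) :
      BaseLaw (.all (Ty.arr ρ (Ty.arr σ τ)) (.all (Ty.arr ρ σ) (.all ρ
        (.eqAt τ (.const (.S ρ σ τ) ⬩ x2 ⬩ x1 ⬩ x0) (x2 ⬩ x0 ⬩ (x1 ⬩ x0))))))
  | recZero :
      BaseLaw (.all T1 (.all Ty.nat (.const (.R Ty.nat) ⬩ x1 ⬩ x0 ⬩ .zero =ₒ x0)))
  | recSucc :
      BaseLaw (.all T1 (.all Ty.nat (.all Ty.nat
        (.const (.R Ty.nat) ⬩ x2 ⬩ x1 ⬩ (x0 +ₒ .one) =ₒ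
          x2 ⬩ (.const (.R Ty.nat) ⬩ x2 ⬩ x1 ⬩ x0)))))
  | ext (ρ τ : Ty) :
      BaseLaw (.all ρ (.all ρ (.all (Ty.arr ρ τ)
        (.eqAt ρ x2 x1 →ₒ .eqAt τ (x0 ⬩ x2) (x0 ⬩ x1)))))
  | induction {Γ : Ctx} (A : Formula (Ty.nat :: Γ)) :
      A.IsQF → BaseLaw (inductionFor A).close

/-- The base theory `RCA₀^ω`. -/
def RCA0w : Set Sentence := {A | BaseLaw A} ∪ QFAC T1 Ty.nat

/-! ### The sentences -/

/-- `f ∈ C`, that is, `f ≤₁ 1`. -/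
def inCantor {Γ : Ctx} (f : Term Γ T1) : Formula Γ := .all Ty.nat (f.wk ⬩ x0 ≤ₒ .one)

/-- The initial segments of `f` and `g` of length `N` are equal. -/
def agree {Γ : Ctx} (f g : Term Γ T1) (N : Term Γ Ty.nat) : Formula Γ :=
  .all Ty.nat (x0 <ₒ N.wk →ₒ f.wk ⬩ x0 =ₒ g.wk ⬩ x0)

/-- `Y ∈ cont`: `(∀f)(∃N)(∀g)(f̄N = ḡN → Y(f) = Y(g))`. -/
def isCont {Γ : Ctx} (Y : Term Γ T2) : Formula Γ :=
  .all T1 (.ex Ty.nat (.all T1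
    (agree x2 x0 x1 →ₒ Y.wk.wk.wk ⬩ x2 =ₒ Y.wk.wk.wk ⬩ x0)))

/-- `(∃²)`: `(∃φ ≤₂ 1)(∀f)[(∃n)(f(n) = 0) ↔ φ(f) = 0]`. -/
def existsTwo : Sentence :=
  .ex T2 (.all T1 (x1 ⬩ x0 ≤ₒ .one) ∧ₒ
    .all T1 (.ex Ty.nat (x1 ⬩ x0 =ₒ .zero) ↔ₒ x1 ⬩ x0 =ₒ .zero))

/-- `(∃³)`: `(∃E ≤₃ 1)(∀Y)[(∃f)(Y(f) = 0) ↔ E(Y) = 0]`. -/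
def existsThree : Sentence :=
  .ex T3 (.all T2 (x1 ⬩ x0 ≤ₒ .one) ∧ₒ
    .all T2 (.ex T1 (x1 ⬩ x0 =ₒ .zero) ↔ₒ x1 ⬩ x0 =ₒ .zero))

/-- `(κ₀³)`: `(∃κ)(∀Y)[κ(Y) = 0 ↔ (∃f ∈ C)(Y(f) > 0)]`. -/
def kappaZero : Sentence :=
  .ex T3 (.all T2 (x1 ⬩ x0 =ₒ .zero ↔ₒ .ex T1 (inCantor x0 ∧ₒ .zero <ₒ x1 ⬩ x0)))

/-- `(Z³)`: `(∃Z)(∀Y)[Z(Y) = 0 ↔ (∀f)(∃N)(∀g)(f̄N = ḡN → Y(f) = Y(g))]`. -/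
def zThree : Sentence :=
  .ex T3 (.all T2 (x1 ⬩ x0 =ₒ .zero ↔ₒ isCont x0))

/-- `FF`: `(∃Φ)(∀Y ∈ cont)(∀f, g ∈ C)(f̄Φ(Y) = ḡΦ(Y) → Y(f) = Y(g))`. -/
def fanFunctional : Sentence :=
  .ex T3 (.all T2 (isCont x0 →ₒ .all T1 (.all T1
    (inCantor x1 →ₒ inCantor x0 →ₒ agree x1 x0 (x3 ⬩ x2) →ₒ x2 ⬩ x1 =ₒ x2 ⬩ x0))))

/-- Finite binary sequences are coded bijectively by numbers: the empty one by `0`, and the extension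
by `i` of the one with code `c` by `2c + 1 + i`. This is the code of that extension. -/
def snoc {Γ : Ctx} (c i : Term Γ Ty.nat) : Term Γ Ty.nat := c +ₒ c +ₒ .one +ₒ i

/-- The binary sequences with codes `c` such that `T(c) = 0` are closed under initial segments. -/
def isTree {Γ : Ctx} (T : Term Γ T1) : Formula Γ :=
  .all Ty.nat (.all Ty.nat
    (x0 ≤ₒ .one →ₒ T.wk.wk ⬩ snoc x1 x0 =ₒ .zero →ₒ T.wk.wk ⬩ x1 =ₒ .zero))

/-- There are infinitely many `c` with `T(c) = 0`. -/
def isInfinite {Γ : Ctx} (T : Term Γ T1) : Formula Γ :=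
  .all Ty.nat (.ex Ty.nat (x1 <ₒ x0 ∧ₒ T.wk.wk ⬩ x0 =ₒ .zero))

/-- `h(k)` is the code of the initial segment of length `k` of `b`, for all `k`. -/
def codesInitial {Γ : Ctx} (h b : Term Γ T1) : Formula Γ :=
  h ⬩ .zero =ₒ .zero ∧ₒ
  .all Ty.nat (h.wk ⬩ (x0 +ₒ .one) =ₒ snoc (h.wk ⬩ x0) (b.wk ⬩ x0))

/-- `WKL`: every infinite binary tree `T` has a path `b ∈ C`. -/
def weakKonig : Sentence :=
  .all T1 (isTree x0 →ₒ isInfinite x0 →ₒ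
    .ex T1 (inCantor x0 ∧ₒ .ex T1 (codesInitial x0 x1 ∧ₒ
      .all Ty.nat (x3 ⬩ (x1 ⬩ x0) =ₒ .zero))))

end HOA

/-! By completeness, and after dividing by pointwise equality, provability becomes truth in all
extensional structures in which `=₀` is identity (`proves_of_isModel`). Inside such a structure one
argues classically. Only the existence of its objects needs care: they come from combinatory terms
with parameters, from quantifier-free choice, and from the functionals assumed.

The engine is a case distinction on `(∃²)`. If it fails, every type-2 object is continuous
(`cont_of_not_existsTwo`), since by Grilliot's trick a discontinuity would decide whether a given
`f` has a zero. Then a constant serves as `Z`, and a fan functional reduces a search through Cantor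
space to one through finitely many binary sequences. If `(∃²)` holds, both `(κ₀³)` and `(Z³)` yield
`(∃³)`, which in turn yields each of them: from `(κ₀³)` because Cantor space then maps onto Baire
space (`KappaZero.existsThree`), from `(Z³)` because each `Y` can be turned into a functional that
is continuous exactly when `Y` has no zero (`ExistsTwo.existsThree`).

It remains to link `WKL` and `FF`. Given `κ₀`, the binary sequences through which pass two points of
Cantor space with different values under `Y` form a tree. A path would be a discontinuity of `Y`, so
by `WKL` a uniform modulus exists, and `QF-AC^{2,0}` selects one for each continuous `Y`.
Conversely, if a tree has no path, the segment with which a point leaves it is a continuous function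
of the point; a modulus for this function bounds the length of the segment, so the tree is finite.
-/

namespace HOA

/-! ### Substitution -/

/-- The substitution in a closed expression. -/
def Sub.nil {Δ : Ctx} : Sub [] Δ := fun _ v => nomatch v

theorem Sub.eq_nil {Δ : Ctx} (s : Sub [] Δ) : s = Sub.nil := by
  funext σ v; cases v

theorem Term.subst_subst {Γ Δ Θ : Ctx} (s : Sub Γ Δ) (r : Sub Δ Θ) {σ : Ty} (t : Term Γ σ) :
    (t.subst s).subst r = t.subst (fun τ v => (s τ v).subst r) := by
  induction t with
  | var v => rfl
  | const c => rfl
  | app f u hf hu => simp only [Term.subst, hf, hu]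

theorem Term.subst_var {Γ : Ctx} {σ : Ty} (t : Term Γ σ) : t.subst (fun _ v => .var v) = t := by
  induction t with
  | var v => rfl
  | const c => rfl
  | app f u hf hu => simp only [Term.subst, hf, hu]

theorem Sub.lift_comp {Γ Δ Θ : Ctx} (s : Sub Γ Δ) (r : Sub Δ Θ) (τ : Ty) :
    (fun σ v => ((s.lift τ) σ v).subst (r.lift τ)) =
      Sub.lift τ (fun σ v => (s σ v).subst r) := by
  funext σ v
  cases v with
  | here => rfl
  | there v => simp only [Sub.lift, Sub.cons, Term.wk, Term.subst_subst]; rfl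

theorem Formula.subst_subst {Γ Δ Θ : Ctx} (s : Sub Γ Δ) (r : Sub Δ Θ) (A : Formula Γ) :
    (A.subst s).subst r = A.subst (fun τ v => (s τ v).subst r) := by
  induction A generalizing Δ Θ with
  | eq t u => simp only [Formula.subst, Term.subst_subst]
  | lt t u => simp only [Formula.subst, Term.subst_subst]
  | falsum => rfl
  | imp A B hA hB => simp only [Formula.subst, hA, hB]
  | all σ A hA => simp only [Formula.subst, hA, Sub.lift_comp]

theorem Formula.subst_var {Γ : Ctx} (A : Formula Γ) : A.subst (fun _ v => .var v) = A := by
  induction A with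
  | eq t u => simp only [Formula.subst, Term.subst_var]
  | lt t u => simp only [Formula.subst, Term.subst_var]
  | falsum => rfl
  | imp A B hA hB => simp only [Formula.subst, hA, hB]
  | @all Γ σ A hA =>
    have : Sub.lift σ (fun _ (v : Var Γ _) => Term.var v) = fun _ v => Term.var v := by
      funext τ v; cases v <;> rfl
    simp only [Formula.subst, this, hA]

theorem Formula.subst_cons_eq_inst {Γ Δ : Ctx} {σ : Ty} (A : Formula (σ :: Γ)) (s : Sub Γ Δ)
    (t : Term Δ σ) : A.subst (Sub.cons t s) = (A.subst (s.lift σ)).inst t := by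
  rw [Formula.inst, Formula.subst_subst]
  congr 1
  funext τ v
  cases v with
  | here => rfl
  | there v => simp only [Sub.lift, Sub.cons, Term.wk, Term.subst_subst]; exact (Term.subst_var _).symm

/-! ### Derivations -/

theorem Deriv.mono {Γ : Ctx} {H H' : Set (Formula Γ)} {A : Formula Γ} (h : Deriv H A)
    (hH : H ⊆ H') : Deriv H' A := by
  induction h with
  | hyp hA => exact .hyp (hH hA)
  | impI _ ih => exact .impI (ih (Set.insert_subset_insert hH))
  | impE _ _ ih₁ ih₂ => exact .impE (ih₁ hH) (ih₂ hH)
  | raa _ ih => exact .raa (ih (Set.insert_subset_insert hH))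
  | allI _ ih => exact .allI (ih (Set.image_mono hH))
  | allE t _ ih => exact .allE t (ih hH)

theorem Deriv.exFalso {Γ : Ctx} {H : Set (Formula Γ)} {A : Formula Γ} (h : Deriv H .falsum) :
    Deriv H A :=
  .raa (h.mono (Set.subset_insert _ _))

/-- Every type has a closed term. -/
def Term.default {Γ : Ctx} : (σ : Ty) → Term Γ σ
  | .nat => .zero
  | .arr σ τ => .app (.const (.K τ σ)) (Term.default τ)

/-- Every sort is inhabited by a closed term, so a fresh variable can be instantiated away. -/
theorem Deriv.falsum_of_wk {Γ : Ctx} {σ : Ty} {H : Set (Formula Γ)}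
    (h : Deriv (Formula.wk (τ := σ) '' H) .falsum) : Deriv H .falsum :=
  Deriv.allE (A := .falsum) (Term.default σ) (.allI h)

/-! ### Structures -/

/-- Structures for the language; the relation symbols are interpreted by arbitrary relations. -/
structure Struc where
  D : Ty → Type
  app {σ τ : Ty} : D (.arr σ τ) → D σ → D τ
  const {σ : Ty} : Const σ → D σ
  eq : D .nat → D .nat → Prop
  lt : D .nat → D .nat → Prop

namespace Struc

variable (S : Struc)

abbrev Env (Γ : Ctx) : Type := ∀ σ : Ty, Var Γ σ → S.D σ

variable {S}

def Env.nil : S.Env [] := fun _ v => nomatch v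

def Env.cons {Γ : Ctx} {τ : Ty} (d : S.D τ) (e : S.Env Γ) : S.Env (τ :: Γ)
  | _, .here => d
  | _, .there v => e _ v

theorem Env.cons_eta {Γ : Ctx} {τ : Ty} (e : S.Env (τ :: Γ)) :
    Env.cons (e τ .here) (fun σ v => e σ (.there v)) = e := by
  funext σ v; cases v <;> rfl

theorem Env.eq_nil (e : S.Env []) : e = Env.nil := by
  funext σ v; cases v

def eval {Γ : Ctx} (e : S.Env Γ) : {σ : Ty} → Term Γ σ → S.D σ
  | _, .var v => e _ v
  | _, .const c => S.const c
  | _, .app t u => S.app (eval e t) (eval e u)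

def Sat : {Γ : Ctx} → Formula Γ → S.Env Γ → Prop
  | _, .eq t u, e => S.eq (eval e t) (eval e u)
  | _, .lt t u, e => S.lt (eval e t) (eval e u)
  | _, .falsum, _ => False
  | _, .imp A B, e => Sat A e → Sat B e
  | _, .all σ A, e => ∀ d : S.D σ, Sat A (Env.cons d e)

theorem eval_subst {Γ Δ : Ctx} (s : Sub Γ Δ) (e : S.Env Δ) {σ : Ty} (t : Term Γ σ) :
    eval e (t.subst s) = eval (fun τ v => eval e (s τ v)) t := by
  induction t with
  | var v => rfl
  | const c => rfl
  | app f u hf hu => simp only [Term.subst, eval, hf, hu]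

@[simp] theorem eval_wk {Γ : Ctx} {σ τ : Ty} (d : S.D τ) (e : S.Env Γ) (t : Term Γ σ) :
    eval (Env.cons d e) t.wk = eval e t :=
  eval_subst _ _ _

theorem sat_subst {Γ Δ : Ctx} (s : Sub Γ Δ) (e : S.Env Δ) (A : Formula Γ) :
    Sat (A.subst s) e ↔ Sat A (fun τ v => eval e (s τ v)) := by
  induction A generalizing Δ with
  | eq t u => simp only [Formula.subst, Sat, eval_subst]
  | lt t u => simp only [Formula.subst, Sat, eval_subst]
  | falsum => rfl
  | imp A B hA hB => simp only [Formula.subst, Sat, hA, hB]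
  | all σ A hA =>
    simp only [Formula.subst, Sat, hA]
    refine forall_congr' fun d => ?_
    refine iff_of_eq (congrArg _ ?_)
    funext τ v
    cases v with
    | here => rfl
    | there v => exact eval_wk d e _

/-- `S` is a model of the theory `T`. -/
def Models (S : Struc) (T : Set Sentence) : Prop := ∀ A ∈ T, Sat (S := S) A Env.nil

end Struc

/-! ### Completeness -/

/-- The elements of the term model: closed terms with a witness constant `wit A e` for each formula
`A` in one variable with parameters `e`. -/
inductive HTerm : Ty → Type
  | const {σ : Ty} : Const σ → HTerm σ
  | app {σ τ : Ty} : HTerm (.arr σ τ) → HTerm σ → HTerm τ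
  | wit {Γ : Ctx} {σ : Ty} : Formula (σ :: Γ) → (∀ τ : Ty, Var Γ τ → HTerm τ) → HTerm σ

/-- Assignments of terms to the witness constants (only the values at `wit A e` matter). -/
abbrev HSub (Δ : Ctx) : Type := ∀ σ : Ty, HTerm σ → Term Δ σ

namespace HTerm

def bind {Δ : Ctx} (s : HSub Δ) : {σ : Ty} → HTerm σ → Term Δ σ
  | _, .const c => .const c
  | _, .app t u => .app (t.bind s) (u.bind s)
  | _, .wit A e => s _ (.wit A e)

/-- Measures the nesting of witnesses: application does not raise it, and a witness lies above its
parameters. Hence a witness of maximal rank among finitely many is in no parameter of the others. -/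
noncomputable def rank : {σ : Ty} → HTerm σ → Ordinal.{0}
  | _, .const _ => 0
  | _, .app t u => max t.rank u.rank
  | _, .wit (Γ := Γ) _ e => (⨆ p : (Σ τ : Ty, Var Γ τ), (e p.1 p.2).rank) + 1

theorem rank_lt_wit {Γ : Ctx} {σ τ : Ty} (A : Formula (σ :: Γ)) (e : ∀ τ : Ty, Var Γ τ → HTerm τ)
    (v : Var Γ τ) : (e τ v).rank < (wit A e).rank := by
  rw [rank, ← Order.succ_eq_add_one, Order.lt_succ_iff]
  exact Ordinal.le_iSup (fun p : (Σ τ : Ty, Var Γ τ) => (e p.1 p.2).rank) ⟨τ, v⟩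

theorem bind_eq_wk {Δ : Ctx} {ρ : Ty} (s : HSub Δ) (s' : HSub (ρ :: Δ)) {σ : Ty} (t : HTerm σ)
    (h : ∀ (τ : Ty) (u : HTerm τ), u.rank ≤ t.rank → s' τ u = (s τ u).wk) :
    t.bind s' = (t.bind s).wk := by
  induction t with
  | const c => rfl
  | app f u hf hu =>
    rw [bind, bind, hf fun τ w hw => h τ w (hw.trans (le_max_left _ _)),
      hu fun τ w hw => h τ w (hw.trans (le_max_right _ _))]
    rfl
  | wit A e _ => exact h _ _ le_rfl

end HTerm

/-- Formulas with parameters from the term model, as functions of the terms assigned to the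
witness constants. -/
abbrev HProp : Type := ∀ Δ : Ctx, HSub Δ → Formula Δ

def HProp.of {Γ : Ctx} (A : Formula Γ) (e : ∀ τ : Ty, Var Γ τ → HTerm τ) : HProp :=
  fun _ s => A.subst (fun τ v => (e τ v).bind s)

def HProp.neg (p : HProp) : HProp := fun Δ s => ¬ₒ (p Δ s)

/-- Finite satisfiability by assignments, in terms of underivability of `⊥`. -/
def HConsistent (W : Set HProp) : Prop :=
  ∀ F : Set HProp, F.Finite → F ⊆ W → ∃ (Δ : Ctx) (s : HSub Δ),
    ¬ Deriv ((fun p : HProp => p Δ s) '' F) .falsum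

/-- Index of a witness constant. -/
structure WitIdx where
  Γ : Ctx
  σ : Ty
  A : Formula (σ :: Γ)
  e : ∀ τ : Ty, Var Γ τ → HTerm τ

namespace WitIdx

def term (i : WitIdx) : HTerm i.σ := .wit i.A i.e

theorem eq_of_term_eq {i j : WitIdx} (h : (⟨i.σ, i.term⟩ : Σ σ, HTerm σ) = ⟨j.σ, j.term⟩) :
    i = j := by
  obtain ⟨Γ, σ, A, e⟩ := i
  obtain ⟨Γ', σ', A', e'⟩ := j
  cases h
  rfl

/-- The Henkin axiom: if `A` holds at its witness, it holds everywhere. -/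
def axiomProp (i : WitIdx) : HProp := fun _ s =>
  i.A.subst (Sub.cons (s _ i.term) (fun τ v => (i.e τ v).bind s)) →ₒ
    (Formula.all i.σ i.A).subst (fun τ v => (i.e τ v).bind s)

end WitIdx

/-- The assignment `s`, weakened, with the new variable for the witness constant `c`. -/
noncomputable def HSub.update {Δ : Ctx} (s : HSub Δ) {σ : Ty} (c : HTerm σ) : HSub (σ :: Δ) :=
  fun τ u => open Classical in
    if h : (⟨τ, u⟩ : Σ τ, HTerm τ) = ⟨σ, c⟩ then (Sigma.mk.inj h).1 ▸ x0 else (s τ u).wk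

theorem HSub.update_self {Δ : Ctx} (s : HSub Δ) {σ : Ty} (c : HTerm σ) :
    s.update c σ c = x0 := by
  simp [HSub.update]

theorem HSub.update_of_ne {Δ : Ctx} (s : HSub Δ) {σ τ : Ty} (c : HTerm σ) (u : HTerm τ)
    (h : (⟨τ, u⟩ : Σ τ, HTerm τ) ≠ ⟨σ, c⟩) : s.update c τ u = (s τ u).wk := by
  simp [HSub.update, h]

theorem HSub.update_of_rank_lt {Δ : Ctx} (s : HSub Δ) {σ τ : Ty} (c : HTerm σ) (u : HTerm τ)
    (h : u.rank < c.rank) : s.update c τ u = (s τ u).wk := by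
  refine s.update_of_ne c u fun he => ?_
  cases he
  exact lt_irrefl _ h

theorem HSub.bind_update {Δ : Ctx} (s : HSub Δ) {σ τ : Ty} (c : HTerm σ) (u : HTerm τ)
    (h : u.rank < c.rank) : u.bind (s.update c) = (u.bind s).wk :=
  HTerm.bind_eq_wk _ _ _ fun _ w hw => s.update_of_rank_lt c w (hw.trans_lt h)

theorem Formula.subst_wk_sub {Γ Δ : Ctx} {ρ : Ty} (A : Formula Γ) (s : Sub Γ Δ) :
    A.subst (fun τ v => (s τ v).wk (τ := ρ)) = (A.subst s).wk :=
  (Formula.subst_subst _ _ _).symm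

/-- A witness `c` of maximal rank occurs in no other axiom of the finite set, so it may be assigned
a fresh variable `x`. If its axiom `A(x) → ∀x A` were refutable from the rest, the rest would prove
`A(x)`, hence `∀x A`, and that proves the axiom. -/
theorem exists_assignment {T : Set Sentence} (hT : ¬ Deriv T .falsum) (L : Finset WitIdx) :
    ∃ (Δ : Ctx) (s : HSub Δ), ¬ Deriv ((fun A : Sentence => A.subst Sub.nil) '' T ∪
      (fun i : WitIdx => i.axiomProp Δ s) '' L) .falsum := by
  classical
  refine Finset.induction_on_max_value (fun i : WitIdx => i.term.rank) L ?_ ?_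
  · refine ⟨[], fun σ _ => Term.default σ, fun h => hT (h.mono ?_)⟩
    rintro _ (⟨A, hA, rfl⟩ | ⟨i, hi, rfl⟩)
    · simpa only [← Sub.eq_nil (fun _ v => Term.var v), Formula.subst_var] using hA
    · simp at hi
  · intro c L hc hmax ih
    obtain ⟨Δ, s, hs⟩ := ih
    refine ⟨c.σ :: Δ, s.update c.term, fun h => hs ?_⟩
    set H := (fun A : Sentence => A.subst Sub.nil) '' T ∪
      (fun i : WitIdx => i.axiomProp Δ s) '' L with hH
    set B := Formula.subst (fun τ v => (c.e τ v).bind s) (.all c.σ c.A) with hB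
    have he : (fun τ v => (c.e τ v).bind (s.update c.term)) =
        fun τ v => ((c.e τ v).bind s).wk := by
      funext τ v
      exact s.bind_update _ _ (HTerm.rank_lt_wit _ _ _)
    have hax : c.axiomProp _ (s.update c.term) =
        (c.A.subst (Sub.lift c.σ (fun τ v => (c.e τ v).bind s)) →ₒ B.wk) := by
      simp only [WitIdx.axiomProp, he, HSub.update_self, Formula.subst_wk_sub, hB]
      rfl
    have h' : Deriv (insert (c.A.subst (Sub.lift c.σ (fun τ v => (c.e τ v).bind s)) →ₒ B.wk)
        (Formula.wk '' H)) .falsum := by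
      refine h.mono ?_
      rintro _ (⟨A, hA, rfl⟩ | ⟨i, hi, rfl⟩)
      · refine Or.inr ⟨_, Or.inl ⟨A, hA, rfl⟩, ?_⟩
        rw [Formula.wk, Formula.subst_subst]
        exact congrArg (A.subst ·) (Sub.eq_nil _)
      · rw [Finset.mem_coe, Finset.mem_insert] at hi
        rcases hi with rfl | hi
        · exact Or.inl hax
        · refine Or.inr ⟨_, Or.inr ⟨i, hi, rfl⟩, ?_⟩
          have hei : (fun τ v => (i.e τ v).bind (s.update c.term)) =
              fun τ v => ((i.e τ v).bind s).wk := by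
            funext τ v
            exact s.bind_update _ _ ((HTerm.rank_lt_wit _ _ _).trans_le (hmax i hi))
          have hi' : s.update c.term _ i.term = (s _ i.term).wk :=
            s.update_of_ne _ _ fun hic => hc (WitIdx.eq_of_term_eq hic ▸ hi)
          have hcons : Sub.cons (s _ i.term).wk (fun τ v => ((i.e τ v).bind s).wk (τ := c.σ)) =
              fun τ v => (Sub.cons (s _ i.term) (fun τ v => (i.e τ v).bind s) τ v).wk := by
            funext τ v
            cases v <;> rfl
          simp only [WitIdx.axiomProp, hei, hi', hcons, Formula.subst_wk_sub]
          rfl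
    -- Under the assumption `¬ A(x)` the refuted axiom holds vacuously; so `A(x)` is derivable, and
    -- `x` is not free in `H`.
    have hB' : Deriv H B := by
      refine .allI (.raa (.impE (.impI (h'.mono (Set.insert_subset_insert
        (Set.subset_insert _ _)))) (.impI (.exFalso (.impE
          (A := c.A.subst (Sub.lift c.σ (fun τ v => (c.e τ v).bind s))) (.hyp ?_) (.hyp ?_))))))
      · exact Or.inr (Or.inl rfl)
      · exact Or.inl rfl
    refine .impE (.impI (.falsum_of_wk (σ := c.σ) ?_)) hB'
    refine .impE (.impI (h'.mono (Set.insert_subset_insert ?_))) (.impI (.hyp ?_))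
    · exact Set.image_mono (Set.subset_insert _ _)
    · exact Or.inr ⟨B, Or.inl rfl, rfl⟩

/-- The formulas that a complete theory of the term model is to contain. -/
def henkinBase (T : Set Sentence) : Set HProp :=
  {p | ∃ A ∈ T, p = .of A (fun _ v => nomatch v)} ∪ Set.range WitIdx.axiomProp

theorem hconsistent_henkinBase {T : Set Sentence} (hT : ¬ Deriv T .falsum) :
    HConsistent (henkinBase T) := by
  classical
  intro F hF hFT
  obtain ⟨L, hL⟩ : ∃ L : Finset WitIdx,
      F ∩ Set.range WitIdx.axiomProp ⊆ WitIdx.axiomProp '' (L : Set WitIdx) := by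
    obtain ⟨L, hL, hL'⟩ := Set.exists_subset_image_finite_and.1
      ⟨F ∩ Set.range WitIdx.axiomProp, by
        rw [Set.image_univ]; exact Set.inter_subset_right, hF.inter_of_left _,
        (subset_rfl : F ∩ Set.range WitIdx.axiomProp ⊆ _)⟩
    exact ⟨hL'.1.toFinset, by simpa using hL'.2⟩
  obtain ⟨Δ, s, hs⟩ := exists_assignment hT L
  refine ⟨Δ, s, fun h => hs (h.mono ?_)⟩
  rintro _ ⟨p, hp, rfl⟩
  rcases hFT hp with ⟨A, hA, rfl⟩ | hp'
  · refine Or.inl ⟨A, hA, ?_⟩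
    simp only [HProp.of]
    congr 1
    funext τ v
    cases v
  · obtain ⟨i, hi, rfl⟩ := hL ⟨hp, hp'⟩
    exact Or.inr ⟨i, hi, rfl⟩

theorem exists_maximal_hconsistent {W : Set HProp} (hW : HConsistent W) :
    ∃ V, W ⊆ V ∧ Maximal HConsistent V := by
  refine zorn_subset_nonempty {V | HConsistent V} (fun c hc hchain hne => ?_) W hW
  refine ⟨⋃₀ c, fun F hF hFc => ?_, fun V hV => Set.subset_sUnion_of_mem hV⟩
  obtain ⟨V, hV, hFV⟩ := hchain.directedOn.exists_mem_subset_of_finite_of_subset_sUnion hne hF hFc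
  exact hc hV F hF hFV

/-- The derivation has to exist under every assignment, because consistency promises only some
assignment for each finite subset. At that assignment a cut removes `p` from the refutation. -/
theorem HConsistent.mem_of_deriv {V : Set HProp} (hV : Maximal HConsistent V) {p : HProp}
    {F : Set HProp} (hF : F.Finite) (hFV : F ⊆ V)
    (h : ∀ (Δ : Ctx) (s : HSub Δ), Deriv ((fun q : HProp => q Δ s) '' F) (p Δ s)) : p ∈ V := by
  by_contra hp
  have : ¬ HConsistent (insert p V) := fun hc =>
    hp (hV.2 hc (Set.subset_insert _ _) (Set.mem_insert _ _))
  simp only [HConsistent, not_forall, not_exists, not_not] at this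
  obtain ⟨G, hG, hGV, hbad⟩ := this
  obtain ⟨Δ, s, hs⟩ := hV.1 (F ∪ (G \ {p})) (hF.union hG.sdiff)
    (Set.union_subset hFV fun q hq => (hGV hq.1).resolve_left hq.2)
  refine hs (.impE (.impI ((hbad Δ s).mono ?_)) ((h Δ s).mono (Set.image_mono Set.subset_union_left)))
  rintro _ ⟨q, hq, rfl⟩
  by_cases hqp : q = p
  · exact Or.inl (hqp ▸ rfl)
  · exact Or.inr ⟨q, Or.inr ⟨hq, hqp⟩, rfl⟩

theorem HConsistent.neg_mem {V : Set HProp} (hV : Maximal HConsistent V) {p : HProp} (hp : p ∉ V) : p.neg ∈ V := by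
  have : ¬ HConsistent (insert p V) := fun hc =>
    hp (hV.2 hc (Set.subset_insert _ _) (Set.mem_insert _ _))
  simp only [HConsistent, not_forall, not_exists, not_not] at this
  obtain ⟨G, hG, hGV, hbad⟩ := this
  refine HConsistent.mem_of_deriv hV (F := G \ {p}) hG.sdiff
    (fun q hq => (hGV hq.1).resolve_left hq.2) fun Δ s => .impI ((hbad Δ s).mono ?_)
  rintro _ ⟨q, hq, rfl⟩
  by_cases hqp : q = p
  · exact Or.inl (hqp ▸ rfl)
  · exact Or.inr ⟨q, ⟨hq, hqp⟩, rfl⟩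

/-- The term model of a set of formulas. -/
def termModel (V : Set HProp) : Struc where
  D := HTerm
  app := .app
  const := .const
  eq t u := (fun _ s => t.bind s =ₒ u.bind s) ∈ V
  lt t u := (fun _ s => t.bind s <ₒ u.bind s) ∈ V

theorem bind_eval_termModel {V : Set HProp} {Γ Δ : Ctx} (e : (termModel V).Env Γ) (s : HSub Δ)
    {σ : Ty} (t : Term Γ σ) :
    HTerm.bind s (Struc.eval e t) = t.subst (fun τ v => HTerm.bind s (e τ v)) := by
  induction t with
  | var v => rfl
  | const c => rfl
  | app f u hf hu =>
    simp only [Term.subst, ← hf, ← hu]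
    rfl

/-- The truth lemma. Maximality settles implication; for the quantifier, the Henkin axiom derives
`∀x A` from the single instance at `wit A e`. -/
theorem sat_termModel {V : Set HProp} (hV : Maximal HConsistent V)
    (hW : Set.range WitIdx.axiomProp ⊆ V) {Γ : Ctx} (A : Formula Γ) (e : (termModel V).Env Γ) :
    Struc.Sat A e ↔ HProp.of A e ∈ V := by
  induction A with
  | eq t u =>
    have : HProp.of (t =ₒ u) e = fun _ s =>
        HTerm.bind s (Struc.eval e t) =ₒ HTerm.bind s (Struc.eval e u) := by
      funext Δ s
      simp only [HProp.of, Formula.subst, bind_eval_termModel]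
    rw [this]
    rfl
  | lt t u =>
    have : HProp.of (t <ₒ u) e = fun _ s =>
        HTerm.bind s (Struc.eval e t) <ₒ HTerm.bind s (Struc.eval e u) := by
      funext Δ s
      simp only [HProp.of, Formula.subst, bind_eval_termModel]
    rw [this]
    rfl
  | falsum =>
    refine ⟨False.elim, fun h => ?_⟩
    obtain ⟨Δ, s, hs⟩ := hV.1 {HProp.of .falsum e} (Set.toFinite _) (by simpa using h)
    exact hs (.hyp ⟨_, rfl, rfl⟩)
  | imp A B hA hB =>
    rw [Struc.Sat, hA, hB]
    refine ⟨fun h => ?_, fun h h' => ?_⟩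
    · by_cases hp : HProp.of A e ∈ V
      · exact HConsistent.mem_of_deriv hV (F := {HProp.of B e}) (Set.toFinite _) (by simpa using h hp)
          fun Δ s => .impI (.hyp (Or.inr ⟨_, rfl, rfl⟩))
      · exact HConsistent.mem_of_deriv hV (F := {(HProp.of A e).neg}) (Set.toFinite _)
          (by simpa using HConsistent.neg_mem hV hp)
          fun Δ s => .impI (.exFalso (.impE (.hyp (Or.inr ⟨_, rfl, rfl⟩)) (.hyp (Or.inl rfl))))
    · exact HConsistent.mem_of_deriv hV (F := {HProp.of (A →ₒ B) e, HProp.of A e}) (Set.toFinite _)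
        (by rintro q (rfl | rfl) <;> assumption)
        fun Δ s => .impE (.hyp ⟨HProp.of (A →ₒ B) e, by simp, rfl⟩)
          (.hyp ⟨HProp.of A e, by simp, rfl⟩)
  | @all Γ σ A hA =>
    simp only [Struc.Sat, hA]
    have hcons : ∀ (d : HTerm σ) (Δ : Ctx) (s : HSub Δ),
        HProp.of A (Struc.Env.cons (S := termModel V) d e) Δ s =
          A.subst (Sub.cons (d.bind s) (fun τ v => HTerm.bind s (e τ v))) := by
      intro d Δ s
      simp only [HProp.of]
      congr 1
      funext τ v
      cases v <;> rfl
    refine ⟨fun h => ?_, fun h d => ?_⟩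
    · have hax := hW ⟨⟨Γ, σ, A, e⟩, rfl⟩
      have hd := h (HTerm.wit A e)
      refine HConsistent.mem_of_deriv hV
        (F := {(⟨Γ, σ, A, e⟩ : WitIdx).axiomProp,
          HProp.of A (Struc.Env.cons (S := termModel V) (HTerm.wit A e) e)}) (Set.toFinite _)
        (by rintro q (rfl | rfl) <;> assumption) fun Δ s => ?_
      refine .impE (.hyp ⟨_, Or.inl rfl, rfl⟩) (.hyp ⟨_, Or.inr rfl, ?_⟩)
      exact hcons _ Δ s
    · refine HConsistent.mem_of_deriv hV (F := {HProp.of (.all σ A) e}) (Set.toFinite _)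
        (by simpa using h) fun Δ s => ?_
      refine (hcons d Δ s).trans (Formula.subst_cons_eq_inst _ _ _) ▸ ?_
      exact .allE _ (.hyp ⟨_, rfl, rfl⟩)

/-- Gödel's completeness theorem. -/
theorem proves_of_models {T : Set Sentence} {A : Sentence}
    (h : ∀ S : Struc, S.Models T → Struc.Sat (S := S) A .nil) : Proves T A := by
  by_contra hA
  have hT : ¬ Deriv (insert (¬ₒ A) T) .falsum := fun hd => hA (.raa hd)
  obtain ⟨V, hTV, hV⟩ := exists_maximal_hconsistent (hconsistent_henkinBase hT)
  have hW : Set.range WitIdx.axiomProp ⊆ V := Set.subset_union_right.trans hTV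
  have hM : ∀ B ∈ insert (¬ₒ A) T, Struc.Sat (S := termModel V) B .nil := fun B hB => by
    rw [sat_termModel hV hW]
    exact hTV (Or.inl ⟨B, hB, rfl⟩)
  exact hM _ (Set.mem_insert _ _) (h _ fun B hB => hM B (Set.mem_insert_of_mem _ hB))

namespace Struc

variable {S : Struc}

/-! ### Truth of defined formulas -/

theorem sat_imp {Γ : Ctx} {A B : Formula Γ} {e : S.Env Γ} :
    Sat (A →ₒ B) e ↔ (Sat A e → Sat B e) := Iff.rfl

theorem sat_all {Γ : Ctx} {σ : Ty} {A : Formula (σ :: Γ)} {e : S.Env Γ} :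
    Sat (.all σ A) e ↔ ∀ d, Sat A (Env.cons d e) := Iff.rfl

theorem sat_neg {Γ : Ctx} {A : Formula Γ} {e : S.Env Γ} : Sat (¬ₒ A) e ↔ ¬ Sat A e := Iff.rfl

theorem sat_or {Γ : Ctx} {A B : Formula Γ} {e : S.Env Γ} :
    Sat (A ∨ₒ B) e ↔ Sat A e ∨ Sat B e := by
  simp only [Formula.or, sat_imp, sat_neg]; tauto

theorem sat_and {Γ : Ctx} {A B : Formula Γ} {e : S.Env Γ} :
    Sat (A ∧ₒ B) e ↔ Sat A e ∧ Sat B e := by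
  simp only [Formula.and, sat_imp, sat_neg]; tauto

theorem sat_iff {Γ : Ctx} {A B : Formula Γ} {e : S.Env Γ} :
    Sat (A ↔ₒ B) e ↔ (Sat A e ↔ Sat B e) := by
  simp only [Formula.iff, sat_and, sat_imp]; tauto

theorem sat_ex {Γ : Ctx} {σ : Ty} {A : Formula (σ :: Γ)} {e : S.Env Γ} :
    Sat (.ex σ A) e ↔ ∃ d, Sat A (Env.cons d e) := by
  simp only [Formula.ex, sat_all, sat_neg, not_forall, not_not]

theorem sat_inst {Γ : Ctx} {σ : Ty} {A : Formula (σ :: Γ)} {t : Term Γ σ} {e : S.Env Γ} :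
    Sat (A.inst t) e ↔ Sat A (Env.cons (eval e t) e) := by
  rw [Formula.inst, sat_subst]
  refine iff_of_eq (congrArg _ ?_)
  funext τ v
  cases v <;> rfl

theorem sat_close {Γ : Ctx} {A : Formula Γ} :
    Sat (S := S) A.close .nil ↔ ∀ e : S.Env Γ, Sat A e := by
  induction Γ with
  | nil => exact ⟨fun h e => e.eq_nil ▸ h, fun h => h _⟩
  | cons σ Γ ih =>
    rw [Formula.close, ih]
    exact ⟨fun h e => e.cons_eta ▸ h _ _, fun h e d => h _⟩

/-! ### The extensional quotient -/

/-- Pointwise equality. -/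
def eqv (S : Struc) : (τ : Ty) → S.D τ → S.D τ → Prop
  | .nat => S.eq
  | .arr _ τ => fun f g => ∀ x, S.eqv τ (S.app f x) (S.app g x)

theorem sat_eqAt {Γ : Ctx} {τ : Ty} {s t : Term Γ τ} {e : S.Env Γ} :
    Sat (.eqAt τ s t) e ↔ S.eqv τ (eval e s) (eval e t) := by
  induction τ generalizing Γ with
  | nat => rfl
  | arr σ τ _ ih =>
    simp only [Formula.eqAt, sat_all, ih, eqv, eval, eval_wk]
    rfl

theorem eqv_refl (h : S.Models RCA0w) (τ : Ty) (x : S.D τ) : S.eqv τ x x := by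
  induction τ with
  | nat => exact h _ (.inl (.basic _ .eq_refl)) x x x
  | arr σ τ _ ih => exact fun y => ih _

theorem eqv_symm (h : S.Models RCA0w) {τ : Ty} {x y : S.D τ} (hxy : S.eqv τ x y) :
    S.eqv τ y x := by
  induction τ with
  | nat => exact h _ (.inl (.basic _ .eq_symm)) x y x hxy
  | arr σ τ _ ih => exact fun z => ih (hxy z)

theorem eqv_trans (h : S.Models RCA0w) {τ : Ty} {x y z : S.D τ} (hxy : S.eqv τ x y)
    (hyz : S.eqv τ y z) : S.eqv τ x z := by
  induction τ with
  | nat => exact h _ (.inl (.basic _ .eq_trans)) z y x hxy hyz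
  | arr σ τ _ ih => exact fun w => ih (hxy w) (hyz w)

/-- This is where the extensionality axiom enters: pointwise equality is a congruence, so
application descends to the quotient. -/
theorem eqv_app (h : S.Models RCA0w) {σ τ : Ty} {f g : S.D (.arr σ τ)} {x y : S.D σ}
    (hfg : S.eqv _ f g) (hxy : S.eqv _ x y) : S.eqv τ (S.app f x) (S.app g y) := by
  have hext := h _ (.inl (.ext σ τ)) x y f
  simp only [sat_imp, sat_eqAt] at hext
  exact eqv_trans h (hext hxy) (hfg y)

def eqvSetoid (h : S.Models RCA0w) (τ : Ty) : Setoid (S.D τ) :=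
  ⟨S.eqv τ, eqv_refl h τ, eqv_symm h, eqv_trans h⟩

/-- The quotient of a model by pointwise equality. -/
def quotient (h : S.Models RCA0w) : Struc where
  D τ := Quotient (eqvSetoid h τ)
  app {_ _} f x := Quotient.map₂ (sa := eqvSetoid h _) (sb := eqvSetoid h _) (sc := eqvSetoid h _)
    S.app (fun _ _ hf _ _ hx => eqv_app h hf hx) f x
  const c := Quotient.mk _ (S.const c)
  eq x y := x = y
  lt x y := Quotient.lift₂ (s₁ := eqvSetoid h _) (s₂ := eqvSetoid h _) S.lt
    (fun a b c d hac hbd => propext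
      ⟨fun hab => h _ (.inl (.basic _ .lt_congr_right)) c d b hbd
        (h _ (.inl (.basic _ .lt_congr_left)) b c a hac hab),
      fun hcd => h _ (.inl (.basic _ .lt_congr_right)) a b d (eqv_symm h hbd)
        (h _ (.inl (.basic _ .lt_congr_left)) d a c (eqv_symm h hac) hcd)⟩) x y

def toQuotient (h : S.Models RCA0w) {τ : Ty} (x : S.D τ) : (quotient h).D τ := Quotient.mk _ x

theorem toQuotient_surjective (h : S.Models RCA0w) {τ : Ty} (x : (quotient h).D τ) :
    ∃ y, toQuotient h y = x := Quotient.exists_rep x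

theorem toQuotient_eq_iff (h : S.Models RCA0w) {τ : Ty} (x y : S.D τ) :
    toQuotient h x = toQuotient h y ↔ S.eqv τ x y :=
  Quotient.eq (r := eqvSetoid h τ)

theorem eval_quotient (h : S.Models RCA0w) {Γ : Ctx} {τ : Ty} (t : Term Γ τ) (e : S.Env Γ) :
    eval (S := quotient h) (fun _ v => toQuotient h (e _ v)) t = toQuotient h (eval e t) := by
  induction t with
  | var v => rfl
  | const c => rfl
  | app f u hf hu => simp only [eval, hf, hu]; rfl

theorem sat_quotient (h : S.Models RCA0w) {Γ : Ctx} (A : Formula Γ) (e : S.Env Γ) :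
    Sat (S := quotient h) A (fun _ v => toQuotient h (e _ v)) ↔ Sat A e := by
  induction A with
  | eq t u => simp only [Sat, eval_quotient]; exact toQuotient_eq_iff h _ _
  | lt t u => simp only [Sat, eval_quotient]; rfl
  | falsum => rfl
  | imp A B hA hB => simp only [Sat, hA, hB]
  | all σ A hA =>
    have hcons : ∀ d : S.D σ, Env.cons (S := quotient h) (toQuotient h d)
        (fun _ v => toQuotient h (e _ v)) = fun _ v => toQuotient h (Env.cons d e _ v) := by
      intro d
      funext τ v
      cases v <;> rfl
    simp only [Sat]
    refine ⟨fun H d => (hA _).1 (hcons d ▸ H _), fun H d => ?_⟩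
    obtain ⟨d, rfl⟩ := toQuotient_surjective h d
    rw [hcons]
    exact (hA _).2 (H d)

theorem sat_quotient_sentence (h : S.Models RCA0w) (A : Sentence) :
    Sat (S := quotient h) A .nil ↔ Sat (S := S) A .nil := by
  rw [← sat_quotient h A .nil]
  exact iff_of_eq (congrArg _ (Env.eq_nil _).symm)

/-- Extensional models of `RCA₀^ω`. -/
class IsModel (S : Struc) : Prop where
  eq_iff (x y : S.D .nat) : S.eq x y ↔ x = y
  app_ext {σ τ : Ty} {f g : S.D (.arr σ τ)} : (∀ x, S.app f x = S.app g x) → f = g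
  models : S.Models RCA0w

theorem isModel_quotient (h : S.Models RCA0w) : (quotient h).IsModel where
  eq_iff _ _ := Iff.rfl
  app_ext {σ τ f g} hfg := by
    obtain ⟨f, rfl⟩ := toQuotient_surjective h f
    obtain ⟨g, rfl⟩ := toQuotient_surjective h g
    exact (toQuotient_eq_iff h _ _).2 fun x => (toQuotient_eq_iff h _ _).1 (hfg (toQuotient h x))
  models A hA := (sat_quotient_sentence h A).2 (h A hA)

end Struc

theorem proves_of_isModel {T : Set Sentence} (hT : RCA0w ⊆ T) {A : Sentence}
    (h : ∀ S : Struc, S.IsModel → S.Models T → Struc.Sat (S := S) A .nil) : Proves T A := by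
  refine proves_of_models fun S hS => ?_
  have hR : S.Models RCA0w := fun B hB => hS B (hT hB)
  exact (Struc.sat_quotient_sentence hR A).1 (h _ (Struc.isModel_quotient hR) fun B hB =>
    (Struc.sat_quotient_sentence hR B).2 (hS B hB))

namespace Struc

variable {S : Struc}

/-! ### Arithmetical notation in a structure -/

instance {σ τ : Ty} : CoeFun (S.D (.arr σ τ)) (fun _ => S.D σ → S.D τ) := ⟨S.app⟩

instance : Zero (S.D .nat) := ⟨S.const .zero⟩
instance : One (S.D .nat) := ⟨S.const .one⟩
instance : Add (S.D .nat) := ⟨fun x y => S.const .add x y⟩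
instance : Mul (S.D .nat) := ⟨fun x y => S.const .mul x y⟩
instance : LT (S.D .nat) := ⟨S.lt⟩

theorem sat_lt {Γ : Ctx} {s t : Term Γ .nat} {e : S.Env Γ} :
    Sat (s <ₒ t) e ↔ eval e s < eval e t := Iff.rfl

@[simp] theorem eval_zero {Γ : Ctx} {e : S.Env Γ} : eval e Term.zero = 0 := rfl
@[simp] theorem eval_one {Γ : Ctx} {e : S.Env Γ} : eval e Term.one = 1 := rfl
@[simp] theorem eval_add {Γ : Ctx} {e : S.Env Γ} {s t : Term Γ .nat} :
    eval e (s +ₒ t) = eval e s + eval e t := rfl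
@[simp] theorem eval_mul {Γ : Ctx} {e : S.Env Γ} {s t : Term Γ .nat} :
    eval e (s *ₒ t) = eval e s * eval e t := rfl
@[simp] theorem eval_app {Γ : Ctx} {e : S.Env Γ} {σ τ : Ty} {s : Term Γ (.arr σ τ)}
    {t : Term Γ σ} : eval e (s ⬩ t) = eval e s (eval e t) := rfl
@[simp] theorem eval_var {Γ : Ctx} {e : S.Env Γ} {σ : Ty} {v : Var Γ σ} :
    eval e (.var v) = e σ v := rfl
@[simp] theorem Env.cons_here {Γ : Ctx} {e : S.Env Γ} {σ : Ty} {d : S.D σ} :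
    Env.cons d e σ .here = d := rfl
@[simp] theorem Env.cons_there {Γ : Ctx} {e : S.Env Γ} {σ τ : Ty} {d : S.D σ} {v : Var Γ τ} :
    Env.cons d e τ (.there v) = e τ v := rfl

theorem sat_choice {σ : Ty} (hT : S.Models (QFAC σ .nat)) {Γ : Ctx}
    {A : Formula (.nat :: σ :: Γ)} (hA : A.IsQF) (e : S.Env Γ)
    (h : ∀ x, ∃ n, Sat A (Env.cons n (Env.cons x e))) :
    ∃ Y : S.D (.arr σ .nat), ∀ x, Sat A (Env.cons (Y x) (Env.cons x e)) := by
  have hc := sat_ex.1 (sat_close.1 (hT _ ⟨Γ, A, hA, rfl⟩) e fun x => sat_ex.2 (h x))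
  obtain ⟨Y, hY⟩ := hc
  refine ⟨Y, fun x => ?_⟩
  have := hY x
  rw [sat_subst] at this
  convert this using 1
  funext τ v
  cases v with
  | here => rfl
  | there v => cases v <;> rfl

/-! ### Terms with parameters -/

/-- Combinatory terms with parameters from a structure. -/
inductive Tm (S : Struc) : Ctx → Ty → Type
  | var {Γ : Ctx} {σ : Ty} : Var Γ σ → Tm S Γ σ
  | par {Γ : Ctx} {σ : Ty} : S.D σ → Tm S Γ σ
  | app {Γ : Ctx} {σ τ : Ty} : Tm S Γ (.arr σ τ) → Tm S Γ σ → Tm S Γ τ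

namespace Tm

def ev {Γ : Ctx} (e : S.Env Γ) : {σ : Ty} → Tm S Γ σ → S.D σ
  | _, .var v => e _ v
  | _, .par d => d
  | _, .app t u => (ev e t) (ev e u)

infixl:100 " ⬘ " => Struc.Tm.app

/-- Bracket abstraction of the last variable. -/
def lam {Γ : Ctx} {σ : Ty} : {τ : Ty} → Tm S (σ :: Γ) τ → Tm S Γ (.arr σ τ)
  | _, .var .here => par (S.const (.S σ (.arr σ σ) σ) (S.const (.K σ (.arr σ σ)))
      (S.const (.K σ σ)))
  | _, .var (.there v) => par (S.const (.K _ σ)) ⬘ var v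
  | _, .par d => par (S.const (.K _ σ) d)
  | _, .app t u => par (S.const (.S _ _ _)) ⬘ t.lam ⬘ u.lam

abbrev v0 {Γ : Ctx} {a : Ty} : Tm S (a :: Γ) a := .var .here
abbrev v1 {Γ : Ctx} {a b : Ty} : Tm S (b :: a :: Γ) a := .var (.there .here)
abbrev v2 {Γ : Ctx} {a b c : Ty} : Tm S (c :: b :: a :: Γ) a := .var (.there (.there .here))
abbrev v3 {Γ : Ctx} {a b c d : Ty} : Tm S (d :: c :: b :: a :: Γ) a :=
  .var (.there (.there (.there .here)))

instance {Γ : Ctx} : Zero (Tm S Γ .nat) := ⟨par 0⟩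
instance {Γ : Ctx} : One (Tm S Γ .nat) := ⟨par 1⟩
instance {Γ : Ctx} : Add (Tm S Γ .nat) := ⟨fun s t => par (S.const .add) ⬘ s ⬘ t⟩
instance {Γ : Ctx} : Mul (Tm S Γ .nat) := ⟨fun s t => par (S.const .mul) ⬘ s ⬘ t⟩

variable {Γ : Ctx} {e : S.Env Γ}

@[simp] theorem ev_var {σ : Ty} (v : Var Γ σ) : ev e (var v) = e σ v := rfl
@[simp] theorem ev_par {σ : Ty} (d : S.D σ) : ev e (par d) = d := rfl
@[simp] theorem ev_app {σ τ : Ty} (t : Tm S Γ (.arr σ τ)) (u : Tm S Γ σ) :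
    ev e (app t u) = (ev e t) (ev e u) := rfl
@[simp] theorem ev_zero : ev e (0 : Tm S Γ .nat) = 0 := rfl
@[simp] theorem ev_one : ev e (1 : Tm S Γ .nat) = 1 := rfl
@[simp] theorem ev_add (s t : Tm S Γ .nat) : ev e (s + t) = ev e s + ev e t := rfl

end Tm

/-- The value lies in the interval from `(x + y)²` to below `(x + y + 1)²`, so it determines `x + y`
and then `x`, without any division. -/
def pair (x y : S.D .nat) : S.D .nat := (x + y) * (x + y) + x

def Tm.pair {Γ : Ctx} (s t : Tm S Γ .nat) : Tm S Γ .nat := (s + t) * (s + t) + s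

@[simp] theorem Tm.ev_pair {Γ : Ctx} {e : S.Env Γ} (s t : Tm S Γ .nat) :
    ev e (Tm.pair s t) = Struc.pair (ev e s) (ev e t) := rfl

/-! ### Extensional models: the ordered semiring of type `0`, combinators, recursion, induction -/

variable [hS : S.IsModel]

theorem sat_eq {Γ : Ctx} {s t : Term Γ .nat} {e : S.Env Γ} :
    Sat (s =ₒ t) e ↔ eval e s = eval e t := IsModel.eq_iff _ _

theorem sat_basicLaw {A : Formula [.nat, .nat, .nat]} (h : BasicLaw A) (x y z : S.D .nat) :
    Sat A (Env.cons x (Env.cons y (Env.cons z Env.nil))) :=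
  hS.models _ (.inl (.basic A h)) z y x

theorem nat_law_eq {s t : Term [.nat, .nat, .nat] .nat} (h : BasicLaw (s =ₒ t))
    (x y z : S.D .nat) :
    eval (Env.cons x (Env.cons y (Env.cons z Env.nil))) s =
      eval (Env.cons x (Env.cons y (Env.cons z Env.nil))) t :=
  sat_eq.1 (sat_basicLaw h x y z)

noncomputable instance : CommSemiring (S.D .nat) where
  add_assoc x y z := nat_law_eq .add_assoc x y z
  add_comm x y := nat_law_eq .add_comm x y x
  add_zero x := nat_law_eq .add_zero x x x
  zero_add x := (nat_law_eq .add_comm _ x x).trans (nat_law_eq .add_zero x x x)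
  mul_assoc x y z := nat_law_eq .mul_assoc x y z
  mul_comm x y := nat_law_eq .mul_comm x y x
  mul_one x := nat_law_eq .mul_one x x x
  one_mul x := (nat_law_eq .mul_comm _ x x).trans (nat_law_eq .mul_one x x x)
  mul_zero x := nat_law_eq .mul_zero x x x
  zero_mul x := (nat_law_eq .mul_comm _ x x).trans (nat_law_eq .mul_zero x x x)
  left_distrib x y z := nat_law_eq .mul_add x y z
  right_distrib x y z := by
    have h := nat_law_eq .mul_add z x y
    have h₁ := nat_law_eq .mul_comm (x + y) z z
    have h₂ := nat_law_eq .mul_comm x z z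
    have h₃ := nat_law_eq .mul_comm y z z
    simp only [eval_add, eval_mul, eval_var, Env.cons_here, Env.cons_there] at h h₁ h₂ h₃
    rw [h₁, h, h₂, h₃]
  nsmul := nsmulRec
  npow n x := npowRec n x

noncomputable instance : LinearOrder (S.D .nat) where
  lt := (· < ·)
  le x y := x < y ∨ x = y
  le_refl x := .inr rfl
  le_trans x y z := by
    rintro (h | rfl) (h' | rfl)
    · exact .inl (sat_basicLaw .lt_trans x y z h h')
    · exact .inl h
    · exact .inl h'
    · exact .inr rfl
  lt_iff_le_not_ge x y := by
    refine ⟨fun h => ⟨.inl h, ?_⟩, ?_⟩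
    · rintro (h' | rfl)
      · exact sat_basicLaw .lt_irrefl x x x (sat_basicLaw .lt_trans x y x h h')
      · exact sat_basicLaw .lt_irrefl y y y h
    · rintro ⟨h | rfl, h'⟩
      · exact h
      · exact absurd (.inr rfl) h'
  le_antisymm x y := by
    rintro (h | rfl) (h' | h')
    · exact (sat_basicLaw .lt_irrefl x x x (sat_basicLaw .lt_trans x y x h h')).elim
    · exact h'.symm
    · rfl
    · rfl
  le_total x y := by
    have h := sat_basicLaw (S := S) .lt_total x y x
    simp only [sat_or, sat_eq, sat_lt, eval_var, Env.cons_here, Env.cons_there] at h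
    grind
  toDecidableLE := Classical.decRel _

theorem nat_lt_add_one_iff {x y : S.D .nat} : x < y + 1 ↔ x ≤ y := by
  have h := sat_basicLaw (S := S) .lt_succ x y x
  simpa only [sat_iff, sat_or, sat_eq, sat_lt, eval_var, eval_add, eval_one, Env.cons_here,
    Env.cons_there, ← le_iff_lt_or_eq] using h

theorem nat_zero_le (x : S.D .nat) : 0 ≤ x := not_lt.1 (sat_basicLaw .not_lt_zero x x x)

noncomputable instance : IsOrderedAddMonoid (S.D .nat) where
  add_le_add_left x y h z := by
    rcases h with h | rfl
    · exact .inl (sat_basicLaw .add_lt_add x y z h)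
    · exact .inr rfl

theorem nat_add_lt_add {x y : S.D .nat} (h : x < y) (z : S.D .nat) : x + z < y + z :=
  sat_basicLaw .add_lt_add x y z h

noncomputable instance : IsOrderedCancelAddMonoid (S.D .nat) where
  le_of_add_le_add_left x y z h := by
    by_contra! h'
    rw [add_comm x, add_comm x] at h
    exact absurd (nat_add_lt_add h' x) (not_lt.2 h)

noncomputable instance : IsStrictOrderedRing (S.D .nat) where
  zero_le_one := nat_zero_le 1
  exists_pair_ne := ⟨0, 1, ((by
    have := (nat_lt_add_one_iff (S := S) (x := 0) (y := 0)).2 le_rfl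
    rw [zero_add] at this
    exact this) : (0 : S.D .nat) < 1).ne⟩
  mul_lt_mul_of_pos_left x h y z hyz := by
    have := sat_basicLaw .mul_lt_mul y z x h hyz
    simp only [sat_lt, eval_mul, eval_var, Env.cons_here, Env.cons_there] at this
    rwa [mul_comm x, mul_comm x]
  mul_lt_mul_of_pos_right x h y z hyz := sat_basicLaw .mul_lt_mul y z x h hyz

theorem sat_le {Γ : Ctx} {s t : Term Γ .nat} {e : S.Env Γ} :
    Sat (s ≤ₒ t) e ↔ eval e s ≤ eval e t := by
  rw [Formula.le, sat_or, sat_lt, sat_eq, le_iff_lt_or_eq]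

theorem eqv_iff {τ : Ty} {x y : S.D τ} : S.eqv τ x y ↔ x = y := by
  induction τ with
  | nat => exact hS.eq_iff _ _
  | arr σ τ _ ih =>
    refine ⟨fun h => hS.app_ext fun z => ih.1 (h z), ?_⟩
    rintro rfl z
    exact ih.2 rfl

@[simp] theorem app_K {σ τ : Ty} (x : S.D σ) (y : S.D τ) : S.const (.K σ τ) x y = x :=
  eqv_iff.1 (sat_eqAt.1 (hS.models _ (.inl (.combK σ τ)) x y))

@[simp] theorem app_S {ρ σ τ : Ty} (x : S.D (.arr ρ (.arr σ τ))) (y : S.D (.arr ρ σ))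
    (z : S.D ρ) : S.const (.S ρ σ τ) x y z = x z (y z) :=
  eqv_iff.1 (sat_eqAt.1 (hS.models _ (.inl (.combS ρ σ τ)) x y z))

theorem rec_zero (f : S.D T1) (m : S.D .nat) : S.const (.R .nat) f m 0 = m :=
  sat_eq.1 (hS.models _ (.inl .recZero) f m)

theorem rec_succ (f : S.D T1) (m n : S.D .nat) :
    S.const (.R .nat) f m (n + 1) = f (S.const (.R .nat) f m n) :=
  sat_eq.1 (hS.models _ (.inl .recSucc) f m n)

theorem sat_induction {Γ : Ctx} {A : Formula (.nat :: Γ)} (hA : A.IsQF) (e : S.Env Γ)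
    (h0 : Sat A (Env.cons 0 e))
    (h : ∀ n, Sat A (Env.cons n e) → Sat A (Env.cons (n + 1) e)) (n : S.D .nat) :
    Sat A (Env.cons n e) := by
  have hind := sat_close.1 (hS.models _ (.inl (.induction A hA))) e
  refine hind (sat_and.2 ⟨sat_inst.2 h0, fun n hn => ?_⟩) n
  rw [sat_subst]
  convert h n hn using 1
  funext τ v
  cases v <;> rfl

theorem models_QFAC_one : S.Models (QFAC T1 .nat) := fun A hA => hS.models A (.inr hA)

theorem nat_zero_lt_one : (0 : S.D .nat) < 1 := zero_lt_one

/-- If `n ≠ 0` were no successor, `k ≠ n` would be inductive in `k`, and it fails at `k = n`. -/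
theorem exists_eq_add_one {n : S.D .nat} (hn : n ≠ 0) : ∃ m, n = m + 1 := by
  by_contra! h
  have hind := sat_induction (A := ¬ₒ (x0 =ₒ x1)) (by simp [Formula.neg, Formula.IsQF])
    (Env.cons n Env.nil)
  simp only [sat_neg, sat_eq, eval_var, Env.cons_here, Env.cons_there] at hind
  exact hind hn.symm (fun k _ hk => h k hk.symm) n rfl

namespace Tm

@[simp] theorem ev_lam {Γ : Ctx} {e : S.Env Γ} {σ τ : Ty} (t : Tm S (σ :: Γ) τ) (d : S.D σ) :
    (ev e t.lam) d = ev (Env.cons d e) t := by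
  induction t using lam.induct with
  | case1 => simp [lam]
  | case2 => simp [lam]
  | case3 => simp [lam]
  | case4 τ τ' t u ht hu => simp [lam, ht, hu]

end Tm

namespace Tm

variable {Γ : Ctx} {e : S.Env Γ}

/-- Definition by cases: `a` if `c = 0`, and `b` otherwise. -/
def cond (c a b : Tm S Γ .nat) : Tm S Γ .nat :=
  par (S.const (.R .nat)) ⬘ (par (S.const (.K .nat .nat)) ⬘ b) ⬘ a ⬘ c

@[simp] theorem ev_cond (c a b : Tm S Γ .nat) :
    ev e (cond c a b) = if ev e c = 0 then ev e a else ev e b := by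
  simp only [cond, ev_app, ev_par]
  split_ifs with h
  · rw [h, rec_zero]
  · obtain ⟨m, hm⟩ := exists_eq_add_one h
    rw [hm, rec_succ, app_K]

end Tm

/-! ### Induction and choice for terms with parameters -/

open Tm

/-- Quantifier-free induction. -/
theorem induction_on {Γ : Ctx} (e : S.Env Γ) (t : Tm S (.nat :: Γ) .nat)
    (h0 : t.ev (Env.cons 0 e) = 0)
    (h : ∀ n, t.ev (Env.cons n e) = 0 → t.ev (Env.cons (n + 1) e) = 0) (n : S.D .nat) :
    t.ev (Env.cons n e) = 0 := by
  have hind := sat_induction (A := x1 ⬩ x0 =ₒ .zero) (by simp [Formula.IsQF])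
    (Env.cons (t.lam.ev e) Env.nil)
  simp only [sat_eq, eval_app, eval_var, Env.cons_here, Env.cons_there, ev_lam, eval_zero] at hind
  exact hind h0 h n

theorem exists_choice {σ : Ty} (hT : S.Models (QFAC σ .nat)) {Γ : Ctx} (e : S.Env Γ)
    (t : Tm S (.nat :: σ :: Γ) .nat) (h : ∀ x, ∃ n, t.ev (Env.cons n (Env.cons x e)) = 0) :
    ∃ Y : S.D (.arr σ .nat), ∀ x, t.ev (Env.cons (Y x) (Env.cons x e)) = 0 := by
  have hc := sat_choice hT (A := x2 ⬩ x1 ⬩ x0 =ₒ .zero) (by simp [Formula.IsQF])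
    (Env.cons (t.lam.lam.ev e) Env.nil)
  simp only [sat_eq, eval_app, eval_var, Env.cons_here, Env.cons_there, ev_lam, eval_zero] at hc
  exact hc h

variable (S) in
-- `<₀` is a relation symbol; its characteristic function is obtained here from `QF-AC^{1,0}`. Since
-- that schema chooses for type-1 arguments, the two numbers are packed as `f 0` and `f 1`.
theorem exists_lt_test : ∃ L : S.D (.arr .nat (.arr .nat .nat)),
    ∀ x y, L x y = 0 ↔ x < y := by
  let A : Formula [.nat, T1] := (x1 ⬩ .zero <ₒ x1 ⬩ .one ∧ₒ x0 =ₒ .zero) ∨ₒ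
    (¬ₒ (x1 ⬩ .zero <ₒ x1 ⬩ .one) ∧ₒ x0 =ₒ .one)
  have hA : A.IsQF := by simp [A, Formula.or, Formula.and, Formula.neg, Formula.IsQF]
  have hc := sat_choice models_QFAC_one hA (Env.nil (S := S))
  simp only [A, sat_or, sat_and, sat_neg, sat_eq, sat_lt, eval_app, eval_var, Env.cons_here,
    Env.cons_there, eval_zero, eval_one] at hc
  obtain ⟨Y, hY⟩ := hc fun f => by
    by_cases h : f 0 < f 1
    · exact ⟨0, .inl ⟨h, rfl⟩⟩
    · exact ⟨1, .inr ⟨h, rfl⟩⟩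
  refine ⟨ev Env.nil (lam (lam (par Y ⬘ lam (cond v0 v2 v1)))), fun x y => ?_⟩
  have h := hY (ev (Env.cons y (Env.cons x Env.nil)) (lam (cond v0 v2 v1)))
  simp only [ev_lam, ev_cond, ev_var, Env.cons_here, Env.cons_there, ev_app, ev_par, if_true,
    one_ne_zero, if_false] at h ⊢
  rcases h with h | h
  · simp [h]
  · simp [h]

namespace Tm

variable {Γ : Ctx} {e : S.Env Γ}

/-! ### Tests: a test holds if its value is `0` -/

noncomputable def tlt (s t : Tm S Γ .nat) : Tm S Γ .nat := par (exists_lt_test S).choose ⬘ s ⬘ t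
def tnot (s : Tm S Γ .nat) : Tm S Γ .nat := cond s 1 0
def tand (s t : Tm S Γ .nat) : Tm S Γ .nat := cond s t 1
def tor (s t : Tm S Γ .nat) : Tm S Γ .nat := cond s 0 t
def timp (s t : Tm S Γ .nat) : Tm S Γ .nat := cond s t 0
noncomputable def tle (s t : Tm S Γ .nat) : Tm S Γ .nat := tnot (tlt t s)
noncomputable def teq (s t : Tm S Γ .nat) : Tm S Γ .nat := tand (tle s t) (tle t s)

@[simp] theorem ev_lt {s t : Tm S Γ .nat} : ev e (tlt s t) = 0 ↔ ev e s < ev e t :=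
  (exists_lt_test S).choose_spec _ _
@[simp] theorem ev_not {s : Tm S Γ .nat} : ev e (tnot s) = 0 ↔ ¬ ev e s = 0 := by
  simp [tnot]
@[simp] theorem ev_and {s t : Tm S Γ .nat} : ev e (tand s t) = 0 ↔ ev e s = 0 ∧ ev e t = 0 := by
  simp only [tand, ev_cond]; split_ifs with h <;> simp [h]
@[simp] theorem ev_or {s t : Tm S Γ .nat} : ev e (tor s t) = 0 ↔ ev e s = 0 ∨ ev e t = 0 := by
  simp only [tor, ev_cond]; split_ifs with h <;> simp [h]
@[simp] theorem ev_imp {s t : Tm S Γ .nat} : ev e (timp s t) = 0 ↔ (ev e s = 0 → ev e t = 0) := by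
  simp only [timp, ev_cond]; split_ifs with h <;> simp [h]
@[simp] theorem ev_le {s t : Tm S Γ .nat} : ev e (tle s t) = 0 ↔ ev e s ≤ ev e t := by
  simp [tle]
@[simp] theorem ev_eq {s t : Tm S Γ .nat} : ev e (teq s t) = 0 ↔ ev e s = ev e t := by
  simp only [teq, ev_and, ev_le]; exact le_antisymm_iff.symm

/-- The sequence that searches for the least zero of `t` step by step. -/
def searchFun (t : Tm S (.nat :: Γ) .nat) : Tm S Γ T1 :=
  -- The step stays at a zero of `t` and otherwise moves on by one. It depends on the current value
  -- only, as `R₀` demands.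
  par (S.const (.R .nat)) ⬘ lam (cond t v0 (v0 + 1)) ⬘ 0

/-- The least `i < n` with `t(i) = 0` if there is one, and `n` otherwise. -/
def search (t : Tm S (.nat :: Γ) .nat) (n : Tm S Γ .nat) : Tm S Γ .nat := searchFun t ⬘ n

/-- Bounded quantification: `∃ i < n, t(i) = 0`. -/
noncomputable def bex (t : Tm S (.nat :: Γ) .nat) (n : Tm S Γ .nat) : Tm S Γ .nat :=
  tlt (search t n) n

/-- Bounded quantification: `∀ i < n, t(i) = 0`. -/
noncomputable def ball (t : Tm S (.nat :: Γ) .nat) (n : Tm S Γ .nat) : Tm S Γ .nat :=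
  tnot (bex (tnot t) n)

theorem searchFun_zero (t : Tm S (.nat :: Γ) .nat) : ev e (searchFun t) 0 = 0 := rec_zero _ _

theorem searchFun_succ (t : Tm S (.nat :: Γ) .nat) (n : S.D .nat) :
    ev e (searchFun t) (n + 1) = if ev (Env.cons (ev e (searchFun t) n) e) t = 0 then
      ev e (searchFun t) n else ev e (searchFun t) n + 1 := by
  simp only [searchFun, ev_app, ev_par, rec_succ, ev_lam, ev_cond, ev_add, ev_one, ev_var,
    Env.cons_here]
  rfl

theorem searchFun_spec (t : Tm S (.nat :: Γ) .nat) (n : S.D .nat) :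
    ev e (searchFun t) n ≤ n ∧
      (ev e (searchFun t) n < n → ev (Env.cons (ev e (searchFun t) n) e) t = 0) := by
  have key := induction_on (Env.cons (ev e (searchFun t)) (Env.cons (ev e t.lam) Env.nil))
    (tand (tle (v1 ⬘ v0) v0) (timp (tlt (v1 ⬘ v0) v0) (v2 ⬘ (v1 ⬘ v0))))
  simp only [ev_and, ev_le, ev_imp, ev_lt, ev_app, ev_var, Env.cons_here, Env.cons_there,
    ev_lam] at key
  refine key ?_ (fun n ih => ?_) n
  · simp [searchFun_zero]
  · rw [searchFun_succ]
    split_ifs with h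
    · exact ⟨ih.1.trans (nat_lt_add_one_iff.2 le_rfl).le, fun _ => h⟩
    · rcases ih.1.lt_or_eq with h' | h'
      · exact absurd (ih.2 h') h
      · simp [h']

theorem ev_search_spec {t : Tm S (.nat :: Γ) .nat} {n : Tm S Γ .nat}
    (h : ev e (search t n) < ev e n) : ev (Env.cons (ev e (search t n)) e) t = 0 :=
  (searchFun_spec t (ev e n)).2 h

theorem searchFun_le_of (t : Tm S (.nat :: Γ) .nat) {i : S.D .nat}
    (hi : ev (Env.cons i e) t = 0) (n : S.D .nat) : ev e (searchFun t) n ≤ i := by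
  have key := induction_on (Env.cons (ev e (searchFun t)) (Env.cons i Env.nil)) (tle (v1 ⬘ v0) v2)
  simp only [ev_le, ev_app, ev_var, Env.cons_here, Env.cons_there] at key
  refine key ?_ (fun n ih => ?_) n
  · exact (searchFun_zero t).trans_le (nat_zero_le i)
  · rw [searchFun_succ]
    split_ifs with h
    · exact ih
    · refine nat_lt_add_one_iff.1 (nat_add_lt_add (ih.lt_of_ne ?_) 1)
      rintro h'
      exact h (h' ▸ hi)

theorem ev_search_le_of {t : Tm S (.nat :: Γ) .nat} {n : Tm S Γ .nat} {i : S.D .nat}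
    (hi : ev (Env.cons i e) t = 0) : ev e (search t n) ≤ i :=
  searchFun_le_of t hi (ev e n)

@[simp] theorem ev_bex {t : Tm S (.nat :: Γ) .nat} {n : Tm S Γ .nat} :
    ev e (bex t n) = 0 ↔ ∃ i < ev e n, ev (Env.cons i e) t = 0 := by
  rw [bex, ev_lt]
  exact ⟨fun h => ⟨_, h, ev_search_spec h⟩, fun ⟨i, hi, h⟩ => (ev_search_le_of h).trans_lt hi⟩

@[simp] theorem ev_ball {t : Tm S (.nat :: Γ) .nat} {n : Tm S Γ .nat} :
    ev e (ball t n) = 0 ↔ ∀ i < ev e n, ev (Env.cons i e) t = 0 := by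
  simp [ball]

end Tm

/-! ### Pairs -/

theorem nat_add_one_le_iff {x y : S.D .nat} : x + 1 ≤ y ↔ x < y := by
  rw [← not_lt, nat_lt_add_one_iff, not_le]

theorem nat_lt_add_one (x : S.D .nat) : x < x + 1 := nat_lt_add_one_iff.2 le_rfl

theorem nat_le_add_right (x y : S.D .nat) : x ≤ x + y := le_add_of_nonneg_right (nat_zero_le y)

theorem nat_le_add_left (x y : S.D .nat) : x ≤ y + x := le_add_of_nonneg_left (nat_zero_le y)

theorem le_pair_left (x y : S.D .nat) : x ≤ pair x y := nat_le_add_left _ _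

theorem le_pair_right (x y : S.D .nat) : y ≤ pair x y := by
  refine (nat_le_add_left y x).trans (le_trans ?_ (nat_le_add_right _ _))
  rcases eq_or_ne (x + y) 0 with h | h
  · rw [h]; exact nat_zero_le _
  · exact le_mul_of_one_le_right (nat_zero_le _)
      (by simpa using nat_add_one_le_iff.2 ((nat_zero_le (x + y)).lt_of_ne h.symm))

theorem pair_lt_pair {x y x' y' : S.D .nat} (h : x + y < x' + y') : pair x y < pair x' y' := by
  have h1 : (x + y + 1) * (x + y + 1) ≤ (x' + y') * (x' + y') :=
    mul_le_mul (nat_add_one_le_iff.2 h) (nat_add_one_le_iff.2 h) (nat_zero_le _) (nat_zero_le _)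
  have h2 := nat_lt_add_one (pair x y)
  have h3 : pair x y + 1 ≤ (x + y + 1) * (x + y + 1) := by
    have : (x + y + 1) * (x + y + 1) = pair x y + 1 + (x + y + y) := by
      simp only [pair]; ring
    rw [this]
    exact nat_le_add_right _ _
  exact h2.trans_le (h3.trans (h1.trans (nat_le_add_right _ _)))

theorem pair_inj {x y x' y' : S.D .nat} (h : pair x y = pair x' y') : x = x' ∧ y = y' := by
  have hs : x + y = x' + y' := by
    rcases lt_trichotomy (x + y) (x' + y') with h' | h' | h'
    · exact absurd h (pair_lt_pair h').ne
    · exact h'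
    · exact absurd h (pair_lt_pair h').ne'
  have hx : x = x' := by
    rw [pair, pair, hs] at h
    exact add_left_cancel h
  subst hx
  exact ⟨rfl, add_left_cancel hs⟩

variable (S) in
-- Both components are bounded by the pair, so bounded search finds them.
noncomputable def fst : S.D T1 :=
  ev Env.nil (lam (search (bex (teq v2 (Tm.pair v1 v0)) (v1 + 1)) (v0 + 1)))

variable (S) in
noncomputable def snd : S.D T1 :=
  ev Env.nil (lam (search (bex (teq v2 (Tm.pair v0 v1)) (v1 + 1)) (v0 + 1)))

@[simp] theorem fst_pair (x y : S.D .nat) : fst S (pair x y) = x := by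
  set t : Tm S [.nat, .nat] .nat := bex (teq v2 (Tm.pair v1 v0)) (v1 + 1) with ht
  have h1 : ev (Env.cons (pair x y) Env.nil) (search t (v0 + 1)) ≤ x := by
    refine ev_search_le_of ?_
    simpa [ht] using ⟨y, nat_lt_add_one_iff.2 (le_pair_right x y), rfl⟩
  have h2 := ev_search_spec (t := t) (n := v0 + 1) (e := Env.cons (pair x y) Env.nil)
    (h1.trans_lt (nat_lt_add_one_iff.2 (le_pair_left x y)))
  simp only [ht, ev_bex, ev_eq, ev_var, Env.cons_here, Env.cons_there, ev_pair] at h2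
  obtain ⟨y', -, h⟩ := h2
  rw [fst, ev_lam]
  exact (pair_inj h).1.symm

@[simp] theorem snd_pair (x y : S.D .nat) : snd S (pair x y) = y := by
  set t : Tm S [.nat, .nat] .nat := bex (teq v2 (Tm.pair v0 v1)) (v1 + 1) with ht
  have h1 : ev (Env.cons (pair x y) Env.nil) (search t (v0 + 1)) ≤ y := by
    refine ev_search_le_of ?_
    simpa [ht] using ⟨x, nat_lt_add_one_iff.2 (le_pair_left x y), rfl⟩
  have h2 := ev_search_spec (t := t) (n := v0 + 1) (e := Env.cons (pair x y) Env.nil)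
    (h1.trans_lt (nat_lt_add_one_iff.2 (le_pair_right x y)))
  simp only [ht, ev_bex, ev_eq, ev_var, Env.cons_here, Env.cons_there, ev_pair] at h2
  obtain ⟨y', -, h⟩ := h2
  rw [snd, ev_lam]
  exact (pair_inj h).2.symm

/-! ### Primitive recursion and subtraction -/

variable (S) in
/-- The step from `(n, y)` to `(n + 1, F n y)`. -/
noncomputable def precStep : S.D (.arr (.arr .nat (.arr .nat .nat)) T1) :=
  ev Env.nil (lam (lam (Tm.pair (par (fst S) ⬘ v0 + 1)
    (v1 ⬘ (par (fst S) ⬘ v0) ⬘ (par (snd S) ⬘ v0)))))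

variable (S) in
/-- Primitive recursion. -/
noncomputable def prec : S.D (.arr (.arr .nat (.arr .nat .nat)) (.arr .nat T1)) :=
  ev Env.nil (lam (lam (lam (par (snd S) ⬘ (par (S.const (.R .nat)) ⬘
    (par (precStep S) ⬘ v2) ⬘ Tm.pair 0 v1 ⬘ v0)))))

theorem prec_eq (F : S.D (.arr .nat (.arr .nat .nat))) (m n : S.D .nat) :
    prec S F m n = snd S (S.const (.R .nat) (precStep S F) (pair 0 m) n) := by
  simp only [prec, ev_lam, ev_app, ev_par, ev_var, Env.cons_here, Env.cons_there, ev_pair, ev_zero]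

theorem prec_zero (F : S.D (.arr .nat (.arr .nat .nat))) (m : S.D .nat) : prec S F m 0 = m := by
  rw [prec_eq, rec_zero, snd_pair]

theorem prec_succ (F : S.D (.arr .nat (.arr .nat .nat))) (m n : S.D .nat) :
    prec S F m (n + 1) = F n (prec S F m n) := by
  have hs : ∀ x, precStep S F x = pair (fst S x + 1) (F (fst S x) (snd S x)) := fun x => by
    simp only [precStep, ev_lam, ev_app, ev_par, ev_var, Env.cons_here, Env.cons_there, ev_pair,
      ev_add, ev_one]
  -- The recursor does not pass the stage to its step, so the first component of the state carries
  -- it; by induction it is `n` at stage `n`.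
  have key := induction_on (Env.cons (S.const (.R .nat) (precStep S F) (pair 0 m)) Env.nil)
    (teq (par (fst S) ⬘ (v1 ⬘ v0)) v0)
  simp only [ev_eq, ev_app, ev_par, ev_var, Env.cons_here, Env.cons_there] at key
  have hf := key (by rw [rec_zero, fst_pair]) (fun n ih => by rw [rec_succ, hs, fst_pair, ih]) n
  rw [prec_eq, prec_eq, rec_succ, hs, snd_pair, hf]

variable (S) in
/-- Truncated subtraction. -/
noncomputable def sub : S.D (.arr .nat (.arr .nat .nat)) :=
  ev Env.nil (lam (lam (search (tle v2 (v1 + v0)) (v1 + 1))))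

theorem add_sub {k n : S.D .nat} (h : k ≤ n) : k + sub S n k = n := by
  set e : S.Env [.nat, .nat] := Env.cons k (Env.cons n Env.nil) with he
  set t : Tm S [.nat, .nat, .nat] .nat := tle v2 (v1 + v0) with ht
  have ht' : ∀ d, ev (Env.cons d e) t = 0 ↔ n ≤ k + d := fun d => by
    simp [ht, he]
  have hsub : sub S n k = ev e (search t (v1 + 1)) := by
    simp only [sub, ev_lam, he, ht]
  rw [hsub]
  set m := ev e (search t (v1 + 1)) with hm
  have h1 : m ≤ n := ev_search_le_of ((ht' n).2 (nat_le_add_left _ _))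
  have h2 : n ≤ k + m := (ht' m).1 (ev_search_spec (h1.trans_lt (nat_lt_add_one n)))
  refine le_antisymm ?_ h2
  rcases eq_or_ne m 0 with h0 | h0
  · rwa [h0, add_zero]
  · obtain ⟨m', hm'⟩ := exists_eq_add_one h0
    by_contra! h3
    have : m ≤ m' := ev_search_le_of ((ht' m').2 (by
      rwa [hm', ← add_assoc, nat_lt_add_one_iff] at h3))
    exact absurd (nat_lt_add_one m') (not_lt.2 (hm' ▸ this))

theorem sub_eq {k n m : S.D .nat} (h : k + m = n) : sub S n k = m :=
  add_left_cancel ((add_sub (h ▸ nat_le_add_right k m)).trans h.symm)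

/-! ### Codes of finite sequences -/

variable (S) in
/-- A coding of finite sequences with entries in `P`, with `0` for the empty sequence. -/
structure Coding where
  snoc : S.D (.arr .nat (.arr .nat .nat))
  init : S.D T1
  last : S.D T1
  P : S.D .nat → Prop
  init_snoc (c : S.D .nat) {i : S.D .nat} (hi : P i) : init (snoc c i) = c
  last_snoc (c : S.D .nat) {i : S.D .nat} (hi : P i) : last (snoc c i) = i

namespace Coding

variable (C : Coding S)

/-- The step in the recursion for `code`. -/
def codeStep : S.D (.arr T1 (.arr .nat (.arr .nat .nat))) :=
  ev Env.nil (lam (lam (lam (par C.snoc ⬘ v0 ⬘ (v2 ⬘ v1)))))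

/-- The code of the initial segment of length `n` of `f`. -/
noncomputable def code : S.D (.arr T1 T1) :=
  ev Env.nil (lam (lam (par (prec S) ⬘ (par C.codeStep ⬘ v1) ⬘ 0 ⬘ v0)))

theorem code_eq (f : S.D T1) (n : S.D .nat) : C.code f n = prec S (C.codeStep f) 0 n := by
  simp [code]

theorem code_zero (f : S.D T1) : C.code f 0 = 0 := by
  rw [code_eq, prec_zero]

theorem code_succ (f : S.D T1) (n : S.D .nat) :
    C.code f (n + 1) = C.snoc (C.code f n) (f n) := by
  rw [code_eq, code_eq, prec_succ]
  simp [codeStep]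

/-- `c` without its last `k` entries. -/
def drop (c k : S.D .nat) : S.D .nat := S.const (.R .nat) C.init c k

theorem drop_zero (c : S.D .nat) : C.drop c 0 = c := rec_zero _ _

theorem drop_succ (c k : S.D .nat) : C.drop c (k + 1) = C.init (C.drop c k) := rec_succ _ _ _

theorem drop_code {f : S.D T1} (hf : ∀ i, C.P (f i)) {k n : S.D .nat} (h : k ≤ n) :
    C.drop (C.code f n) k = C.code f (sub S n k) := by
  have key := induction_on (Env.cons n (Env.cons (C.code f) Env.nil)) (timp (tle v0 v1)
    (teq (par (S.const (.R .nat)) ⬘ par C.init ⬘ (v2 ⬘ v1) ⬘ v0) (v2 ⬘ (par (sub S) ⬘ v1 ⬘ v0))))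
  simp only [ev_imp, ev_le, ev_eq, ev_app, ev_par, ev_var, Env.cons_here, Env.cons_there] at key
  refine key (fun _ => ?_) (fun k ih hk => ?_) k h
  · rw [sub_eq (zero_add n)]
    exact C.drop_zero _
  · have hk' : k ≤ n := (nat_lt_add_one k).le.trans hk
    have hs : sub S n k = sub S n (k + 1) + 1 := sub_eq (by
      rw [← add_assoc, add_right_comm, add_sub hk])
    have ih := ih hk'
    rw [hs, code_succ] at ih
    exact (C.drop_succ _ _).trans ((congrArg (S.app C.init) ih).trans (C.init_snoc _ (hf _)))

/-- The sequence with code `c` of length `n`, continued by `0`. -/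
noncomputable def decode : S.D (.arr .nat (.arr .nat T1)) :=
  ev Env.nil (lam (lam (lam (cond (tlt v0 v2)
    (par C.last ⬘ (par (S.const (.R .nat)) ⬘ par C.init ⬘ v1 ⬘ (par (sub S) ⬘ v2 ⬘ (v0 + 1)))) 0))))

theorem decode_of_lt {i n : S.D .nat} (h : i < n) (c : S.D .nat) :
    C.decode n c i = C.last (C.drop c (sub S n (i + 1))) := by
  simp [decode, drop, h]

theorem decode_of_le {i n : S.D .nat} (h : n ≤ i) (c : S.D .nat) : C.decode n c i = 0 := by
  simp [decode, h]

theorem decode_code {f : S.D T1} (hf : ∀ i, C.P (f i)) {i n : S.D .nat} (h : i < n) :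
    C.decode n (C.code f n) i = f i := by
  have h' : i + 1 ≤ n := nat_add_one_le_iff.2 h
  have hs : sub S n (i + 1) ≤ n := by
    have := nat_le_add_left (sub S n (i + 1)) (i + 1)
    rwa [add_sub h'] at this
  rw [decode_of_lt _ h, C.drop_code hf hs,
    sub_eq (m := i + 1) (by rw [add_comm, add_sub h']), code_succ, C.last_snoc _ (hf i)]

theorem code_congr {f g : S.D T1} {n : S.D .nat} (h : ∀ i < n, f i = g i) :
    C.code f n = C.code g n := by
  have key := induction_on (Env.cons n (Env.cons (C.code f) (Env.cons (C.code g) Env.nil)))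
    (timp (tle v0 v1) (teq (v2 ⬘ v0) (v3 ⬘ v0)))
  simp only [ev_imp, ev_le, ev_eq, ev_app, ev_var, Env.cons_here, Env.cons_there] at key
  refine key (fun _ => ?_) (fun k ih hk => ?_) n le_rfl
  · rw [code_zero, code_zero]
  · rw [code_succ, code_succ, h k (nat_add_one_le_iff.1 hk), ih ((nat_lt_add_one k).le.trans hk)]

end Coding

variable (S) in
/-- Coding of sequences of arbitrary numbers. -/
noncomputable def pairCoding : Coding S where
  snoc := ev Env.nil (lam (lam (Tm.pair v1 v0)))
  init := fst S
  last := snd S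
  P _ := True
  init_snoc c i _ := by simp
  last_snoc c i _ := by simp

/-! ### Binary sequences -/

variable (S) in
-- The extensions of `p` have the codes `2p + 1` and `2p + 2`, so the predecessor of `c` is the
-- least `p` with `c ≤ 2p + 2`. At `c = 0` the search gives `0`.
noncomputable def binInit : S.D T1 := ev Env.nil (lam (search (tle v1 (v0 + v0 + 1 + 1)) v0))

variable (S) in
noncomputable def binLast : S.D T1 :=
  ev Env.nil (lam (cond (teq v0 (par (binInit S) ⬘ v0 + par (binInit S) ⬘ v0 + 1)) 0 1))

theorem nat_le_one_iff {x : S.D .nat} : x ≤ 1 ↔ x = 0 ∨ x = 1 := by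
  rw [le_iff_lt_or_eq, ← zero_add (1 : S.D .nat), nat_lt_add_one_iff, le_iff_lt_or_eq]
  have := nat_zero_le x
  grind

theorem binInit_le {c p : S.D .nat} (h : c ≤ p + p + 1 + 1) : binInit S c ≤ p := by
  rw [binInit, ev_lam]
  exact ev_search_le_of (by simpa using h)

theorem le_binInit (c : S.D .nat) : c ≤ binInit S c + binInit S c + 1 + 1 := by
  rcases eq_or_ne c 0 with rfl | hc
  · exact nat_zero_le _
  · obtain ⟨d, hd⟩ := exists_eq_add_one hc
    have hdc : d < c := hd ▸ nat_lt_add_one d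
    have h1 : binInit S c ≤ d := binInit_le (by
      have := nat_zero_le d
      have := nat_zero_lt_one (S := S)
      grind)
    have h2 := h1.trans_lt hdc
    rw [binInit, ev_lam] at h2 ⊢
    simpa using ev_search_spec h2

theorem binInit_snoc (c : S.D .nat) {i : S.D .nat} (hi : i ≤ 1) :
    binInit S (c + c + 1 + i) = c := by
  refine le_antisymm (binInit_le (by grind)) ?_
  have h := le_binInit (c + c + 1 + i)
  by_contra! h'
  rw [← nat_add_one_le_iff] at h'
  have := nat_zero_le i
  have := nat_zero_lt_one (S := S)
  grind

theorem binLast_eq (c : S.D .nat) :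
    binLast S c = if c = binInit S c + binInit S c + 1 then 0 else 1 := by
  simp [binLast]

variable (S) in
/-- The coding of binary sequences. -/
noncomputable def binCoding : Coding S where
  snoc := ev Env.nil (lam (lam (v1 + v1 + 1 + v0)))
  init := binInit S
  last := binLast S
  P i := i ≤ 1
  init_snoc c i hi := by simpa using binInit_snoc c hi
  last_snoc c i hi := by
    simp only [ev_lam, ev_add, ev_var, ev_one, Env.cons_here, Env.cons_there, binLast_eq,
      binInit_snoc c hi]
    rcases nat_le_one_iff.1 hi with rfl | rfl <;> simp

@[simp] theorem binCoding_snoc (c i : S.D .nat) : (binCoding S).snoc c i = c + c + 1 + i := by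
  simp [binCoding]

theorem binLast_le (c : S.D .nat) : binLast S c ≤ 1 := by
  rw [binLast_eq]
  split_ifs
  · exact nat_zero_le 1
  · exact le_rfl

theorem binInit_binLast {c : S.D .nat} (hc : c ≠ 0) :
    binInit S c + binInit S c + 1 + binLast S c = c := by
  rw [binLast_eq]
  split_ifs with h
  · rw [add_zero, ← h]
  · refine le_antisymm ?_ (le_binInit c)
    rw [nat_add_one_le_iff]
    refine lt_of_le_of_ne ?_ (Ne.symm h)
    rcases eq_or_ne (binInit S c) 0 with h0 | h0
    · rw [h0, add_zero, nat_add_one_le_iff]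
      exact (nat_zero_le c).lt_of_ne hc.symm
    · obtain ⟨m, hm⟩ := exists_eq_add_one h0
      have : m + m + 1 + 1 < c := by
        by_contra! h'
        exact absurd (binInit_le h') (not_le.2 (hm ▸ nat_lt_add_one m))
      rw [← nat_add_one_le_iff] at this
      rw [hm]
      grind

theorem binInit_lt {c : S.D .nat} (hc : c ≠ 0) : binInit S c < c := by
  have := binInit_binLast hc
  have := nat_zero_le (binLast S c)
  have := nat_zero_le (binInit S c)
  have := nat_zero_lt_one (S := S)
  grind

theorem decode_le_one (n c i : S.D .nat) : (binCoding S).decode n c i ≤ 1 := by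
  rcases lt_or_ge i n with h | h
  · rw [Coding.decode_of_lt _ h]
    exact binLast_le _
  · rw [Coding.decode_of_le _ h]
    exact nat_zero_le 1

theorem binInit_zero : binInit S 0 = 0 :=
  le_antisymm (binInit_le (nat_zero_le _)) (nat_zero_le _)

/-- Every number codes a binary sequence. -/
theorem exists_code_eq (c : S.D .nat) : ∃ (f : S.D T1) (n : S.D .nat),
    (∀ i, f i ≤ 1) ∧ (binCoding S).code f n = c := by
  set C := binCoding S with hC
  set e : S.Env [.nat] := Env.cons c Env.nil with he
  set t : Tm S [.nat, .nat] .nat := par (S.const (.R .nat)) ⬘ par C.init ⬘ v1 ⬘ v0 with ht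
  have ht' : ∀ k, ev (Env.cons k e) t = C.drop c k := fun k => by simp [ht, he, Coding.drop]
  -- Each `init` lowers a nonzero code, so the empty sequence is reached within `c` steps.
  have hz : ∀ k, C.drop c k + k ≤ c ∨ C.drop c k = 0 := by
    have key := induction_on e (tor (tle (t + v0) v1) t)
    simp only [ev_or, ev_le, ev_add, ht', ev_var, Env.cons_here, Env.cons_there] at key
    refine key (.inl ?_) fun k ih => ?_
    · rw [C.drop_zero, add_zero]
      exact le_rfl
    · rw [C.drop_succ]
      rcases eq_or_ne (C.drop c k) 0 with h | h
      · right
        rw [h]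
        exact binInit_zero
      · left
        have h1 := ih.resolve_right h
        have h2 := nat_add_one_le_iff.2 (binInit_lt h)
        have h3 : C.init (C.drop c k) + 1 ≤ C.drop c k := h2
        grind
  have hcc : C.drop c c = 0 := by
    rcases hz c with h | h
    · exact le_antisymm (by simpa using h) (nat_zero_le _)
    · exact h
  -- The length is the least number of steps to the empty sequence. By minimality all earlier codes
  -- are nonzero, so `binInit_binLast` can rebuild them entry by entry.
  set n := ev e (search t (v0 + 1)) with hn
  have hnc : n ≤ c := ev_search_le_of (by rw [ht', hcc])
  have hn0 : C.drop c n = 0 := by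
    rw [← ht']
    exact ev_search_spec (hnc.trans_lt (nat_lt_add_one c))
  have hlt : ∀ k < n, C.drop c k ≠ 0 := fun k hk h =>
    absurd (ev_search_le_of (n := v0 + 1) ((ht' k).trans h)) (not_le.2 hk)
  refine ⟨C.decode n c, n, decode_le_one n c, ?_⟩
  have key := induction_on (Env.cons n (Env.cons (C.code (C.decode n c)) e)) (timp (tle v0 v1)
    (teq (v2 ⬘ v0) (par (S.const (.R .nat)) ⬘ par C.init ⬘ v3 ⬘ (par (sub S) ⬘ v1 ⬘ v0))))
  simp only [ev_imp, ev_le, ev_eq, ev_app, ev_par, ev_var, Env.cons_here, Env.cons_there, he]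
    at key
  have := key (fun _ => ?_) (fun i ih hi => ?_) n le_rfl
  · rw [this, sub_eq (add_zero n)]
    exact C.drop_zero c
  · rw [C.code_zero, sub_eq (zero_add n)]
    exact hn0.symm
  · have hi' := nat_add_one_le_iff.1 hi
    have hs : sub S n i = sub S n (i + 1) + 1 := sub_eq (by
      rw [← add_assoc, add_right_comm, add_sub hi])
    rw [C.code_succ, ih hi'.le, C.decode_of_lt hi', hs]
    change C.snoc (C.drop c (sub S n (i + 1) + 1)) _ = C.drop c _
    rw [C.drop_succ, hC, binCoding_snoc, ← hC]
    refine binInit_binLast (hlt _ ?_)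
    have h1 := add_sub hi
    have h2 := nat_zero_le i
    have h3 := nat_zero_lt_one (S := S)
    grind

/-- Turns quantifiers over binary sequences of a given length into bounded ones. -/
theorem code_le_code_one {f : S.D T1} (hf : ∀ i, f i ≤ 1) (n : S.D .nat) :
    (binCoding S).code f n ≤ (binCoding S).code (S.const (.K .nat .nat) 1) n := by
  have key := induction_on (Env.cons f Env.nil) (tle (par (binCoding S).code ⬘ v1 ⬘ v0)
    (par (binCoding S).code ⬘ par (S.const (.K .nat .nat) 1) ⬘ v0))
  simp only [ev_le, ev_app, ev_par, ev_var, Env.cons_here, Env.cons_there, Coding.code_zero,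
    Coding.code_succ, binCoding_snoc, app_K] at key
  exact key le_rfl (fun n ih => add_le_add (add_le_add (add_le_add ih ih) le_rfl) (hf n)) n

theorem code_mono {f : S.D T1} {m n : S.D .nat} (h : m ≤ n) :
    (binCoding S).code f m ≤ (binCoding S).code f n := by
  have key := induction_on (Env.cons m (Env.cons f Env.nil)) (timp (tle v1 v0)
    (tle (par (binCoding S).code ⬘ v2 ⬘ v1) (par (binCoding S).code ⬘ v2 ⬘ v0)))
  simp only [ev_imp, ev_le, ev_app, ev_par, ev_var, Env.cons_here, Env.cons_there] at key
  refine key (fun h => ?_) (fun n ih h => ?_) n h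
  · rw [le_antisymm h (nat_zero_le m)]
  · rcases h.lt_or_eq with h | rfl
    · refine (ih (nat_lt_add_one_iff.1 h)).trans ?_
      rw [Coding.code_succ, binCoding_snoc, add_assoc, add_assoc]
      exact nat_le_add_right _ _
    · exact le_rfl

theorem le_code (f : S.D T1) (n : S.D .nat) : n ≤ (binCoding S).code f n := by
  have key := induction_on (Env.cons f Env.nil) (tle v0 (par (binCoding S).code ⬘ v1 ⬘ v0))
  simp only [ev_le, ev_app, ev_par, ev_var, Env.cons_here, Env.cons_there, Coding.code_succ,
    binCoding_snoc] at key
  refine key (nat_zero_le _) (fun n ih => ?_) n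
  have := nat_zero_le (f n)
  have := nat_zero_le n
  grind

/-- The length of a coded binary sequence, and its entries, are determined by the code. -/
theorem code_inj {f g : S.D T1} (hf : ∀ i, f i ≤ 1) (hg : ∀ i, g i ≤ 1) {m n : S.D .nat}
    (h : (binCoding S).code f m = (binCoding S).code g n) : m = n ∧ ∀ i < n, f i = g i := by
  set C := binCoding S with hC
  have main : ∀ {f g : S.D T1}, (∀ i, f i ≤ 1) → (∀ i, g i ≤ 1) → ∀ {m n : S.D .nat},
      C.code f m = C.code g n → m ≤ n → m = n := by
    intro f g hf hg m n h hmn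
    -- Dropping `m` entries empties the sequence, yet also leaves one of length `n - m`. A length is
    -- at most its code, so `n - m = 0`.
    have h1 : C.drop (C.code f m) m = 0 := by
      rw [C.drop_code hf le_rfl, sub_eq (add_zero m), C.code_zero]
    rw [h, C.drop_code hg hmn] at h1
    have h2 := le_code g (sub S n m)
    rw [← hC, h1] at h2
    have h3 := add_sub hmn
    rw [le_antisymm h2 (nat_zero_le _), add_zero] at h3
    exact h3
  have hmn : m = n := (le_total m n).elim (main hf hg h) fun h' => (main hg hf h.symm h').symm
  subst hmn
  refine ⟨rfl, fun i hi => ?_⟩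
  rw [← C.decode_code hf hi, h, C.decode_code hg hi]

/-! ### The principles, in a structure -/

section Principles

variable (S : Struc)

def InCantor {S : Struc} [LE (S.D .nat)] (f : S.D T1) : Prop := ∀ i, f i ≤ 1

/-- Continuity on Baire space. -/
def Cont {S : Struc} (Y : S.D T2) : Prop :=
  ∀ f : S.D T1, ∃ N : S.D .nat, ∀ g : S.D T1, (∀ i < N, f i = g i) → Y f = Y g

def ZThree : Prop := ∃ Z : S.D T3, ∀ Y, Z Y = 0 ↔ Cont Y

variable [S.IsModel]

def ExistsTwo : Prop := ∃ φ : S.D T2, (∀ f, φ f ≤ 1) ∧ ∀ f, (∃ n, f n = 0) ↔ φ f = 0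

def ExistsThree : Prop := ∃ E : S.D T3, (∀ Y, E Y ≤ 1) ∧ ∀ Y, (∃ f, Y f = 0) ↔ E Y = 0

def KappaZero : Prop := ∃ κ : S.D T3, ∀ Y, κ Y = 0 ↔ ∃ f, InCantor f ∧ 0 < Y f

def FanFunctional : Prop := ∃ Φ : S.D T3, ∀ Y, Cont Y → ∀ f g, InCantor f → InCantor g →
  (∀ i < Φ Y, f i = g i) → Y f = Y g

def WeakKonig : Prop := ∀ T : S.D T1, (∀ c i, i ≤ 1 → T (c + c + 1 + i) = 0 → T c = 0) →
  (∀ n, ∃ c, n < c ∧ T c = 0) →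
  ∃ b, InCantor b ∧ ∃ h : S.D T1, (h 0 = 0 ∧ ∀ k, h (k + 1) = h k + h k + 1 + b k) ∧
    ∀ k, T (h k) = 0

end Principles

theorem ite_le_one (p : Prop) [Decidable p] : (if p then (0 : S.D .nat) else 1) ≤ 1 := by
  split_ifs
  · exact nat_zero_le 1
  · exact le_rfl

/-! ### `(∃³)` and `(∃²) + (Z³)` -/

/-- A number is the value at `0` of a function: `f` has a zero iff `g ↦ f (g 0)` has one. -/
theorem ExistsThree.existsTwo (h : ExistsThree S) : ExistsTwo S := by
  obtain ⟨E, hE1, hE⟩ := h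
  refine ⟨ev Env.nil (lam (par E ⬘ lam (v1 ⬘ (v0 ⬘ 0)))), fun f => ?_, fun f => ?_⟩
  · simpa using hE1 _
  · rw [ev_lam, ev_app, ev_par, ← hE]
    simp only [ev_lam, ev_app, ev_var, ev_zero, Env.cons_here, Env.cons_there]
    exact ⟨fun ⟨n, hn⟩ => ⟨S.const (.K .nat .nat) n, by simpa using hn⟩, fun ⟨g, hg⟩ => ⟨_, hg⟩⟩

theorem ExistsThree.zThree (h : ExistsThree S) : ZThree S := by
  obtain ⟨E, -, hE⟩ := h
  -- `E` decides each of the three quantifiers in the definition of continuity; the number `N`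
  -- enters as the value at `0` of a function.
  refine ⟨ev Env.nil (lam (tnot (par E ⬘ lam (tnot (par E ⬘ lam (tnot (par E ⬘ lam (tnot
    (timp (ball (teq (v3 ⬘ v0) (v1 ⬘ v0)) (v1 ⬘ 0)) (teq (v3 ⬘ v2) (v3 ⬘ v0))))))))))),
    fun Y => ?_⟩
  simp only [ev_lam, ev_not, ev_app, ev_par, ← hE, ev_imp, ev_ball, ev_eq, ev_var, ev_zero,
    Env.cons_here, Env.cons_there, not_exists, not_not]
  refine forall_congr' fun f => ?_
  push Not
  exact ⟨fun ⟨N, hN⟩ => ⟨_, hN⟩, fun ⟨N, hN⟩ => ⟨S.const (.K .nat .nat) N, by simpa using hN⟩⟩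

open scoped Classical in
-- `V Y` is `0` at those `f` that vanish nowhere and satisfy `Y (f - 1) = 0`, and `1` elsewhere.
-- Without a zero of `Y` it is constant. A zero `h` of `Y` makes it discontinuous at `h + 1`, since
-- functions with a zero come arbitrarily close. So `Z (V Y)` decides whether `Y` has a zero.
theorem ExistsTwo.existsThree (h : ExistsTwo S) (hZ : ZThree S) : ExistsThree S := by
  obtain ⟨φ, -, hφ⟩ := h
  obtain ⟨Z, hZ⟩ := hZ
  set V : S.D (.arr T2 T2) := ev Env.nil (lam (lam (cond (tand (tnot (par φ ⬘ v0))
    (v1 ⬘ lam (par (sub S) ⬘ (v1 ⬘ v0) ⬘ 1))) 0 1))) with hV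
  set p : S.D (.arr T1 T1) := ev Env.nil (lam (lam (par (sub S) ⬘ (v1 ⬘ v0) ⬘ 1))) with hp
  have hV' : ∀ Y f, V Y f = if (∀ n, f n ≠ 0) ∧ Y (p f) = 0 then 0 else 1 := by
    intro Y f
    have hpf : ev (Env.cons f (Env.cons Y Env.nil)) (lam (par (sub S) ⬘ (v1 ⬘ v0) ⬘ 1)) = p f :=
      hS.app_ext fun x => by simp [hp]
    simp only [hV, ev_lam, ev_cond, ev_and, ev_not, ev_app, ev_par, ev_var, Env.cons_here,
      Env.cons_there, ← hφ, ev_zero, ev_one, hpf, not_exists]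
  have key : ∀ Y, Cont (V Y) ↔ ¬ ∃ f, Y f = 0 := by
    intro Y
    refine ⟨fun hc => ?_, fun hY f => ⟨0, fun g _ => ?_⟩⟩
    · rintro ⟨h, hh⟩
      obtain ⟨N, hN⟩ := hc (ev Env.nil (lam (par h ⬘ v0 + 1)))
      -- Agrees with `h + 1` below `N` and vanishes from `N` on.
      have := hN (ev Env.nil (lam (cond (tlt v0 (par N)) (par h ⬘ v0 + 1) 0)))
        fun i hi => by simp [hi]
      have hne : ∀ x : S.D .nat, x + 1 ≠ 0 := fun x hx =>
        absurd (nat_lt_add_one x) (not_lt.2 (hx ▸ nat_zero_le x))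
      rw [hV', hV', if_pos, if_neg] at this
      · exact zero_ne_one this
      · rintro ⟨h', -⟩
        exact h' N (by simp)
      · refine ⟨fun n => by simpa using hne _, ?_⟩
        rw [← hh]
        congr 1
        exact hS.app_ext fun x => by simp [hp, sub_eq (add_comm 1 (h x))]
    · rw [hV', hV', if_neg fun h => hY ⟨_, h.2⟩, if_neg fun h => hY ⟨_, h.2⟩]
  refine ⟨ev Env.nil (lam (cond (tnot (par Z ⬘ (par V ⬘ v0))) 0 1)), fun Y => ?_, fun Y => ?_⟩
  · simp only [ev_lam, ev_cond]
    exact ite_le_one _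
  · simp only [ev_lam, ev_cond, ev_not, ev_app, ev_par, ev_var, Env.cons_here, hZ, key, ev_zero,
      ev_one, not_not]
    split_ifs with h <;> simp [h]

/-- `sg` retracts Baire space onto Cantor space, so a search through Cantor space is one for `Y ∘
sg` through all functions. -/
theorem ExistsThree.kappaZero (h : ExistsThree S) : KappaZero S := by
  obtain ⟨E, -, hE⟩ := h
  set sg : S.D (.arr T1 T1) := ev Env.nil (lam (lam (cond (v1 ⬘ v0) 0 1))) with hsg
  refine ⟨ev Env.nil (lam (par E ⬘ lam (tlt 0 (v1 ⬘ (par sg ⬘ v0))))), fun Y => ?_⟩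
  simp only [ev_lam, ev_app, ev_par, ← hE, ev_lt, ev_zero, ev_var, Env.cons_here, Env.cons_there]
  refine ⟨fun ⟨f, hf⟩ => ⟨sg f, fun i => ?_, hf⟩, fun ⟨f, hf, hY⟩ => ⟨f, ?_⟩⟩
  · simpa [hsg] using ite_le_one _
  · have : sg f = f := hS.app_ext fun i => by
      rcases nat_le_one_iff.1 (hf i) with h | h <;> simp [hsg, h]
    rwa [this]

/-- Quantification over Cantor space, for `κ` as in `(κ₀³)`. -/
def Tm.cantorEx {Γ : Ctx} (κ : S.D T3) (t : Tm S (T1 :: Γ) .nat) : Tm S Γ .nat :=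
  par κ ⬘ lam (cond t 1 0)

theorem Tm.ev_cantorEx {κ : S.D T3} (hκ : ∀ Y, κ Y = 0 ↔ ∃ f, InCantor f ∧ 0 < Y f) {Γ : Ctx}
    {e : S.Env Γ} {t : Tm S (T1 :: Γ) .nat} :
    ev e (cantorEx κ t) = 0 ↔ ∃ f, InCantor f ∧ ev (Env.cons f e) t = 0 := by
  rw [cantorEx, ev_app, ev_par, hκ]
  refine exists_congr fun f => and_congr_right fun _ => ?_
  rw [ev_lam, ev_cond]
  split_ifs with h <;> simp [h]

open scoped Classical in
/-- Arithmetical comprehension maps Cantor space onto Baire space. -/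
theorem KappaZero.existsThree (h : KappaZero S) (h2 : ExistsTwo S) : ExistsThree S := by
  obtain ⟨κ, hκ⟩ := h
  obtain ⟨φ, hφ1, hφ⟩ := h2
  -- `φ` only tells whether `f` has a zero; choice turns this into a selector `μ` of a zero.
  obtain ⟨μ, hμ⟩ := exists_choice (S := S) models_QFAC_one Env.nil
    (timp (par φ ⬘ v1) (v1 ⬘ v0)) (fun f => by
      simp only [ev_imp, ev_app, ev_par, ev_var, Env.cons_here, Env.cons_there, ← hφ]
      by_cases h : ∃ n, f n = 0
      · exact ⟨h.choose, fun _ => h.choose_spec⟩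
      · exact ⟨0, fun h' => absurd h' h⟩)
  simp only [ev_imp, ev_app, ev_par, ev_var, Env.cons_here, Env.cons_there, ← hφ] at hμ
  -- `D h` reads the zeros of `h` as the graph of a function.
  set D : S.D (.arr T1 T1) :=
    ev Env.nil (lam (lam (par μ ⬘ lam (v2 ⬘ Tm.pair v1 v0)))) with hD
  have honto : ∀ f, ∃ h, InCantor h ∧ D h = f := by
    intro f
    set h : S.D T1 := ev Env.nil (lam (par φ ⬘ lam (teq v1 (Tm.pair v0 (par f ⬘ v0))))) with hh
    have hpair : ∀ n m, h (pair n m) = 0 ↔ m = f n := by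
      intro n m
      simp only [hh, ev_lam, ev_app, ev_par, ← hφ, ev_eq, ev_var, Env.cons_here, Env.cons_there,
        ev_pair]
      exact ⟨fun ⟨k, hk⟩ => by obtain ⟨rfl, rfl⟩ := pair_inj hk; rfl, fun hm => ⟨n, hm ▸ rfl⟩⟩
    refine ⟨h, fun i => by simpa [hh] using hφ1 _, hS.app_ext fun n => ?_⟩
    have := hμ (ev (Env.cons n (Env.cons h Env.nil)) (lam (v2 ⬘ Tm.pair v1 v0)))
    simp only [ev_lam, ev_app, ev_var, Env.cons_here, Env.cons_there, ev_pair, hpair] at this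
    simpa only [hD, ev_lam, ev_app, ev_par] using this ⟨_, rfl⟩
  refine ⟨ev Env.nil (lam (cond (cantorEx κ (v1 ⬘ (par D ⬘ v0))) 0 1)),
    fun Y => ?_, fun Y => ?_⟩
  · simp only [ev_lam, ev_cond]
    exact ite_le_one _
  · have : (∃ f, Y f = 0) ↔ ∃ f, InCantor f ∧ Y (D f) = 0 := by
      refine ⟨fun ⟨f, hf⟩ => ?_, fun ⟨h, _, hY⟩ => ⟨D h, hY⟩⟩
      obtain ⟨h, hC, rfl⟩ := honto f
      exact ⟨h, hC, hf⟩
    simp only [ev_lam, ev_cond, ev_app, ev_par, ev_cantorEx hκ, ev_var, Env.cons_here,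
      Env.cons_there, ev_one, ev_zero, this]
    split_ifs with h <;> simp [h]

/-! ### Discontinuous functionals -/

/-- Grilliot's trick. -/
theorem existsTwo_of_sequence (Y : S.D T2) (y : S.D T1) (G : S.D (.arr .nat T1))
    (hG : ∀ j, ∀ i < j, G j i = y i) (hY : ∀ j, Y (G j) ≠ Y y) : ExistsTwo S := by
  set s : S.D (.arr T1 T1) := ev Env.nil (lam (lam (search (v2 ⬘ v0) (v0 + 1)))) with hs
  have hs1 : ∀ f i, s f i < i + 1 → f (s f i) = 0 := by
    intro f i hi
    simp only [hs, ev_lam] at hi ⊢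
    simpa using ev_search_spec (t := v2 ⬘ v0) hi
  have hs2 : ∀ f i j, f j = 0 → s f i ≤ j := by
    intro f i j hj
    simp only [hs, ev_lam]
    exact ev_search_le_of (by simpa using hj)
  -- `H f` is `G j` if `j` is the least zero of `f`, and `y` if there is none. Its value at `i`
  -- needs only the zeros up to `i`, because every `G j` with `j > i` agrees with `y` at `i`.
  set H : S.D (.arr T1 T1) := ev Env.nil (lam (lam (cond (tlt (par s ⬘ v1 ⬘ v0) (v0 + 1))
    (par G ⬘ (par s ⬘ v1 ⬘ v0) ⬘ v0) (par y ⬘ v0)))) with hH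
  have hH' : ∀ f i, H f i = if s f i < i + 1 then G (s f i) i else y i := by
    intro f i
    simp [hH]
  refine ⟨ev Env.nil (lam (cond (tnot (teq (par Y ⬘ (par H ⬘ v0)) (par Y ⬘ par y))) 0 1)),
    fun f => ?_, fun f => ?_⟩
  · simp only [ev_lam, ev_cond]
    exact ite_le_one _
  · have key : (∃ n, f n = 0) ↔ Y (H f) ≠ Y y := by
      refine ⟨fun ⟨n, hn⟩ => ?_, fun hne => ?_⟩
      · have hlt := (hs2 f n n hn).trans_lt (nat_lt_add_one n)
        have hj0 : f (s f n) = 0 := hs1 f n hlt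
        have hjle : ∀ k, f k = 0 → s f n ≤ k := hs2 f n
        set j := s f n
        have : H f = G j := hS.app_ext fun i => by
          rw [hH']
          split_ifs with hi
          · rw [le_antisymm (hs2 f i j hj0) (hjle _ (hs1 f i hi))]
          · refine (hG j i ?_).symm
            rw [not_lt, nat_add_one_le_iff] at hi
            exact hi.trans_le (hs2 f i j hj0)
        rw [this]
        exact hY j
      · by_contra! hno
        refine hne (congrArg _ (hS.app_ext fun i => ?_))
        rw [hH', if_neg fun hi => hno _ (hs1 f i hi)]
    simp only [ev_lam, ev_cond, ev_not, ev_eq, ev_app, ev_par, ev_var, Env.cons_here, key, ev_zero,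
      ev_one]
    split_ifs with h <;> simp [h]

/-- Grilliot's trick needs a sequence of functions, while choice supplies only numbers. Truncations
`tr g j`, being coded by numbers, bridge the gap. Either for some `y` almost all truncations differ
from `y` under `Y`, and they form the sequence; or every `g` has arbitrarily long truncations with
the same value, and these witness the discontinuity at `x`. -/
theorem cont_of_not_existsTwo (h : ¬ ExistsTwo S) (Y : S.D T2) : Cont Y := by
  by_contra hY
  refine h ?_
  set tr : S.D (.arr T1 (.arr .nat T1)) :=
    ev Env.nil (lam (lam (lam (cond (tlt v0 v1) (v2 ⬘ v0) 0)))) with htr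
  have htr' : ∀ f n i, tr f n i = if i < n then f i else 0 := by
    intro f n i
    simp [htr]
  by_cases hcase : ∃ y N, ∀ j, N ≤ j → Y (tr y j) ≠ Y y
  · obtain ⟨y, N, hyN⟩ := hcase
    refine existsTwo_of_sequence Y y (ev Env.nil (lam (par tr ⬘ par y ⬘ (v0 + par N))))
      (fun j i hi => ?_) fun j => ?_
    · simp [htr', hi.trans_le (nat_le_add_right j N)]
    · simpa using hyN _ (nat_le_add_left N j)
  · push Not at hcase
    simp only [Cont, not_forall, not_exists] at hY
    obtain ⟨x, hx⟩ := hY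
    set C := pairCoding S with hC
    set d : S.D (.arr .nat T1) :=
      ev Env.nil (lam (par C.decode ⬘ (par (fst S) ⬘ v0) ⬘ (par (snd S) ⬘ v0))) with hd
    -- Choice over numbers is simulated by choice over type `1`: only `f 0` matters, and `f` is
    -- later the constant `j`.
    obtain ⟨W, hW⟩ := exists_choice (S := S) models_QFAC_one Env.nil
      (tand (ball (teq (par x ⬘ v0) (par d ⬘ v1 ⬘ v0)) (v1 ⬘ 0))
        (tnot (teq (par Y ⬘ par x) (par Y ⬘ (par d ⬘ v0))))) (fun f => by
      obtain ⟨g, hg⟩ := hx (f 0)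
      push Not at hg
      obtain ⟨j, hj, hYj⟩ := hcase g (f 0)
      have hdj : d (pair j (C.code g j)) = tr g j := hS.app_ext fun i => by
        rw [htr']
        simp only [hd, ev_lam, ev_app, ev_par, ev_var, Env.cons_here, fst_pair, snd_pair]
        split_ifs with hi
        · exact C.decode_code (fun _ => trivial) hi
        · exact C.decode_of_le (not_lt.1 hi) _
      refine ⟨pair j (C.code g j), ?_⟩
      simp only [ev_and, ev_ball, ev_not, ev_eq, ev_app, ev_par, ev_var, Env.cons_here,
        Env.cons_there, ev_zero, hdj, htr', hYj]
      refine ⟨fun i hi => ?_, hg.2⟩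
      rw [if_pos (hi.trans_le hj), hg.1 i hi])
    simp only [ev_and, ev_ball, ev_not, ev_eq, ev_app, ev_par, ev_var, Env.cons_here,
      Env.cons_there, ev_zero] at hW
    refine existsTwo_of_sequence Y x
      (ev Env.nil (lam (par d ⬘ (par W ⬘ (par (S.const (.K .nat .nat)) ⬘ v0)))))
      (fun j i hi => ?_) fun j => ?_
    · simpa using ((hW (S.const (.K .nat .nat) j)).1 i (by simpa using hi)).symm
    · simpa using Ne.symm (hW (S.const (.K .nat .nat) j)).2

/-! ### The fan functional -/

/-- Otherwise the binary sequences that lie on two points of Cantor space with different values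
under `Y` form an infinite tree, and `κ` makes it an object of type `1`. On a path `b`, continuity
of `Y` at `b` forbids two such points near `b`. -/
theorem exists_uniform_modulus (hκ : KappaZero S) (hW : WeakKonig S) {Y : S.D T2} (hY : Cont Y) :
    ∃ N, ∀ f g, InCantor f → InCantor g → (∀ i < N, f i = g i) → Y f = Y g := by
  by_contra! hno
  obtain ⟨κ, hκ⟩ := hκ
  set C := binCoding S with hC
  -- The length of the common segment is at most its code `c` (`le_code`), so the search for it is
  -- bounded by `c + 1`.
  set T : S.D T1 := ev Env.nil (lam (cantorEx κ (cantorEx κ (tand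
    (bex (tand (teq (par C.code ⬘ v2 ⬘ v0) v3) (teq (par C.code ⬘ v1 ⬘ v0) v3)) (v2 + 1))
    (tnot (teq (par Y ⬘ v1) (par Y ⬘ v0))))))) with hT
  have hT' : ∀ c, T c = 0 ↔ ∃ f, InCantor f ∧ ∃ g, InCantor g ∧
      (∃ k, C.code f k = c ∧ C.code g k = c) ∧ Y f ≠ Y g := by
    intro c
    simp only [hT, ev_lam, ev_cantorEx hκ, ev_and, ev_bex, ev_eq, ev_not, ev_app, ev_par, ev_var,
      ev_add, ev_one, Env.cons_here, Env.cons_there]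
    refine exists_congr fun f => and_congr_right fun _ => exists_congr fun g =>
      and_congr_right fun _ => and_congr_left fun _ => exists_congr fun k => ?_
    exact ⟨And.right, fun h => ⟨nat_lt_add_one_iff.2 (h.1 ▸ le_code f k), h⟩⟩
  have htree : ∀ c i, i ≤ 1 → T (c + c + 1 + i) = 0 → T c = 0 := fun c i hi hc => by
    obtain ⟨f, hf, g, hg, ⟨k, hkf, hkg⟩, hne⟩ := (hT' _).1 hc
    have hk : k ≠ 0 := by
      rintro rfl
      rw [C.code_zero] at hkf
      have := nat_zero_le c
      have := nat_zero_le i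
      have := nat_zero_lt_one (S := S)
      grind
    obtain ⟨m, rfl⟩ := exists_eq_add_one hk
    rw [C.code_succ, hC, binCoding_snoc] at hkf hkg
    refine (hT' _).2 ⟨f, hf, g, hg, ⟨m, ?_, ?_⟩, hne⟩
    · rw [← binInit_snoc (C.code f m) (hf m), hkf, binInit_snoc c hi]
    · rw [← binInit_snoc (C.code g m) (hg m), hkg, binInit_snoc c hi]
  have hinf : ∀ n, ∃ c, n < c ∧ T c = 0 := fun n => by
    obtain ⟨f, g, hf, hg, hfg, hne⟩ := hno (n + 1)
    refine ⟨C.code f (n + 1), (nat_lt_add_one n).trans_le (le_code _ _),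
      (hT' _).2 ⟨f, hf, g, hg, ⟨n + 1, rfl, ?_⟩, hne⟩⟩
    exact C.code_congr fun i hi => (hfg i hi).symm
  obtain ⟨b, hb, h, ⟨h0, hs⟩, hpath⟩ := hW T htree hinf
  have hcode : ∀ k, h k = C.code b k := by
    have key := induction_on (Env.cons h (Env.cons (C.code b) Env.nil))
      (teq (v1 ⬘ v0) (v2 ⬘ v0))
    simp only [ev_eq, ev_app, ev_var, Env.cons_here, Env.cons_there] at key
    refine key ?_ fun k ih => ?_
    · rw [h0, C.code_zero]
    · rw [hs, C.code_succ, ih, hC, binCoding_snoc]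
  obtain ⟨N, hN⟩ := hY b
  obtain ⟨f, hf, g, hg, ⟨k, hkf, hkg⟩, hne⟩ := (hT' _).1 (hpath N)
  rw [hcode] at hkf hkg
  refine hne ((hN f ?_).symm.trans (hN g ?_))
  · exact fun i hi => ((code_inj hf hb hkf).2 i hi).symm
  · exact fun i hi => ((code_inj hg hb hkg).2 i hi).symm

/-- With `κ` and `Z` as parameters, "if `Y` is continuous, then `N` is a uniform modulus" becomes
quantifier-free, so `QF-AC^{2,0}` selects a modulus. -/
theorem KappaZero.fanFunctional (hκ : KappaZero S) (hW : WeakKonig S) (hZ : ZThree S)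
    (hT : S.Models (QFAC T2 .nat)) : FanFunctional S := by
  have hU := fun Y => exists_uniform_modulus (Y := Y) hκ hW
  obtain ⟨κ, hκ⟩ := hκ
  obtain ⟨Z, hZ⟩ := hZ
  obtain ⟨Φ, hΦ⟩ := exists_choice (S := S) hT Env.nil
    (timp (par Z ⬘ v1) (tnot (cantorEx κ (cantorEx κ (tand
      (ball (teq (v2 ⬘ v0) (v1 ⬘ v0)) v2) (tnot (teq (v3 ⬘ v1) (v3 ⬘ v0)))))))) (fun Y => by
    simp only [ev_imp, ev_not, ev_cantorEx hκ, ev_and, ev_ball, ev_eq, ev_app, ev_par, ev_var,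
      Env.cons_here, Env.cons_there, hZ]
    by_cases hY : Cont Y
    · obtain ⟨N, hN⟩ := hU Y hY
      exact ⟨N, fun _ ⟨f, hf, g, hg, hfg, hne⟩ => hne (hN f g hf hg hfg)⟩
    · exact ⟨0, fun h => absurd h hY⟩)
  simp only [ev_imp, ev_not, ev_cantorEx hκ, ev_and, ev_ball, ev_eq, ev_app, ev_par, ev_var,
    Env.cons_here, Env.cons_there, hZ] at hΦ
  refine ⟨Φ, fun Y hY f g hf hg hfg => ?_⟩
  by_contra hne
  exact hΦ Y hY ⟨f, hf, g, hg, hfg, hne⟩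

/-- If `T` has no path, each point `f` of Cantor space leaves `T` at a least length `n f`, and `Y f`
codes that segment. `Y` is continuous. If `n f > Φ Y`, changing the last entry of the segment
changes `Y f`, but the modulus does not notice. Hence `n` is bounded by `Φ Y`, and `T` is finite. -/
theorem FanFunctional.weakKonig (h : FanFunctional S) : WeakKonig S := by
  intro T htree hinf
  by_contra hno
  obtain ⟨Φ, hΦ⟩ := h
  set C := binCoding S with hC
  set sg : S.D (.arr T1 T1) := ev Env.nil (lam (lam (cond (v1 ⬘ v0) 0 1))) with hsg
  have hsg1 : ∀ f, InCantor (sg f) := fun f i => by simpa [hsg] using ite_le_one _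
  have hsgC : ∀ f, InCantor f → sg f = f := fun f hf => hS.app_ext fun i => by
    rcases nat_le_one_iff.1 (hf i) with h | h <;> simp [hsg, h]
  have hsgc : ∀ f g i, f i = g i → sg f i = sg g i := fun f g i h => by
    rcases eq_or_ne (g i) 0 with h' | h' <;> simp [hsg, h, h']
  -- Choice and continuity refer to all of Baire space, hence the retraction `sg`. The chosen length
  -- need not be least; it only bounds the search for `n`.
  obtain ⟨N₀, hN₀⟩ := exists_choice (S := S) models_QFAC_one Env.nil
    (tnot (par T ⬘ (par C.code ⬘ (par sg ⬘ v1) ⬘ v0))) (fun f => by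
      simp only [ev_not, ev_app, ev_par, ev_var, Env.cons_here, Env.cons_there]
      by_contra! hf
      refine hno ⟨sg f, hsg1 f, C.code (sg f), ⟨C.code_zero _, fun k => ?_⟩, hf⟩
      rw [C.code_succ, hC, binCoding_snoc])
  simp only [ev_not, ev_app, ev_par, ev_var, Env.cons_here, Env.cons_there] at hN₀
  set t : Tm S [.nat, T1] .nat := tnot (par T ⬘ (par C.code ⬘ (par sg ⬘ v1) ⬘ v0)) with ht
  have ht' : ∀ f k, ev (Env.cons k (Env.cons f Env.nil)) t = 0 ↔ ¬ T (C.code (sg f) k) = 0 :=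
    fun f k => by simp [ht]
  set n : S.D T2 := ev Env.nil (lam (search t (par N₀ ⬘ v0 + 1))) with hn
  have hn1 : ∀ f k, ¬ T (C.code (sg f) k) = 0 → n f ≤ k := fun f k hk => by
    rw [hn, ev_lam]
    exact ev_search_le_of ((ht' f k).2 hk)
  have hn2 : ∀ f, ¬ T (C.code (sg f) (n f)) = 0 := fun f => by
    have h1 := (hn1 f _ (hN₀ f)).trans_lt (nat_lt_add_one _)
    rw [← ht', hn, ev_lam] at *
    exact ev_search_spec (by simpa using h1)
  set Y : S.D T2 := ev Env.nil (lam (par C.code ⬘ (par sg ⬘ v0) ⬘ (par n ⬘ v0))) with hY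
  have hY' : ∀ f, Y f = C.code (sg f) (n f) := fun f => by simp [hY]
  have hcont : Cont Y := fun f => ⟨n f, fun g hfg => by
    have hcode : ∀ k ≤ n f, C.code (sg f) k = C.code (sg g) k := fun k hk =>
      C.code_congr fun i hi => hsgc f g i (hfg i (hi.trans_le hk))
    have h1 : n g ≤ n f := hn1 g _ (hcode _ le_rfl ▸ hn2 f)
    have h2 : n f ≤ n g := hn1 f _ ((hcode _ h1).symm ▸ hn2 g)
    rw [hY', hY', hcode _ le_rfl, le_antisymm h1 h2]⟩
  have hbound : ∀ f, InCantor f → n f ≤ Φ Y := by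
    intro f hf
    by_contra! hlt
    have hn0 : n f ≠ 0 := fun h => absurd (nat_zero_le (Φ Y)) (not_le.2 (h ▸ hlt))
    obtain ⟨m, hm⟩ := exists_eq_add_one hn0
    have hm' : Φ Y ≤ m := nat_lt_add_one_iff.1 (hm ▸ hlt)
    -- `f` flipped at `m`, the last position of the segment; `m ≥ Φ Y`, so `g` agrees with `f` below
    -- `Φ Y`.
    set g : S.D T1 := ev Env.nil (lam (cond (teq v0 (par m)) (cond (par f ⬘ v0) 1 0)
      (par f ⬘ v0))) with hg
    have hg' : ∀ i, g i = if i = m then (if f i = 0 then 1 else 0) else f i := fun i => by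
      simp only [hg, ev_lam, ev_cond, ev_eq, ev_app, ev_par, ev_var, Env.cons_here]
      congr
    have hgC : InCantor g := fun i => by
      rw [hg']
      split_ifs
      · exact le_rfl
      · exact nat_zero_le 1
      · exact hf i
    have hfg := hΦ Y hcont f g hf hgC fun i hi => by
      rw [hg', if_neg (hi.trans_le hm').ne]
    rw [hY', hY', hsgC f hf, hsgC g hgC] at hfg
    have heq := (code_inj hgC hf hfg.symm).2 m (hm ▸ nat_lt_add_one m)
    rw [hg', if_pos rfl] at heq
    split_ifs at heq with h
    · exact one_ne_zero (heq.trans h)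
    · exact h heq.symm
  -- Any code above that of the all-ones sequence of length `Φ Y` belongs to a longer sequence.
  obtain ⟨c, hc, hTc⟩ := hinf (C.code (S.const (.K .nat .nat) 1) (Φ Y))
  obtain ⟨f, k, hf, rfl⟩ := exists_code_eq c
  have hk : Φ Y < k := by
    by_contra! hk
    exact absurd ((code_le_code_one hf k).trans (code_mono hk)) (not_le.2 hc)
  -- Once outside the tree at length `n f`, the segments of `f` stay outside.
  have key := induction_on (Env.cons (n f) (Env.cons T (Env.cons (C.code f) Env.nil)))
    (timp (tle v1 v0) (tnot (v2 ⬘ (v3 ⬘ v0))))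
  simp only [ev_imp, ev_le, ev_not, ev_app, ev_var, Env.cons_here, Env.cons_there] at key
  have hnf := hn2 f
  rw [hsgC f hf] at hnf
  refine key (fun h => ?_) (fun i ih hi h => ?_) k ((hbound f hf).trans hk.le) hTc
  · rwa [le_antisymm h (nat_zero_le _)] at hnf
  · rcases hi.lt_or_eq with hi | hi
    · refine ih (nat_lt_add_one_iff.1 hi) (htree _ _ (hf i) ?_)
      rwa [C.code_succ, hC, binCoding_snoc] at h
    · exact hnf (hi ▸ h)

/-! ### The equivalences -/

theorem KappaZero.zThree (h : KappaZero S) : ZThree S := by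
  by_cases h2 : ExistsTwo S
  · exact (h.existsThree h2).zThree
  · exact ⟨S.const (.K .nat T2) 0, fun Y => by simpa using cont_of_not_existsTwo h2 Y⟩

/-- Without `(∃²)` every `Y` is continuous, so `Φ Y` is a modulus for every `Y`. It then suffices to
test the decoded sequences of length `Φ Y`, continued by `0`. -/
theorem FanFunctional.kappaZero (h : FanFunctional S) (hZ : ZThree S) : KappaZero S := by
  by_cases h2 : ExistsTwo S
  · exact (h2.existsThree hZ).kappaZero
  · obtain ⟨Φ, hΦ⟩ := h
    set C := binCoding S with hC
    refine ⟨ev Env.nil (lam (bex (tlt 0 (v1 ⬘ (par C.decode ⬘ (par Φ ⬘ v1) ⬘ v0)))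
      (par C.code ⬘ par (S.const (.K .nat .nat) 1) ⬘ (par Φ ⬘ v0) + 1))), fun Y => ?_⟩
    simp only [ev_lam, ev_bex, ev_lt, ev_app, ev_par, ev_var, ev_add, ev_one, ev_zero,
      Env.cons_here, Env.cons_there, nat_lt_add_one_iff]
    refine ⟨fun ⟨c, _, hc⟩ => ⟨_, decode_le_one _ _, hc⟩, fun ⟨f, hf, hY⟩ => ?_⟩
    refine ⟨C.code f (Φ Y), code_le_code_one hf _, ?_⟩
    rwa [hΦ Y (cont_of_not_existsTwo h2 Y) _ f (decode_le_one _ _) hf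
      fun i hi => C.decode_code hf hi]

theorem kappaZero_and_weakKonig_iff (hT : S.Models (QFAC T2 .nat)) :
    KappaZero S ∧ WeakKonig S ↔ ZThree S ∧ FanFunctional S :=
  ⟨fun h => ⟨h.1.zThree, h.1.fanFunctional h.2 h.1.zThree hT⟩,
    fun h => ⟨h.2.kappaZero h.1, h.2.weakKonig⟩⟩

theorem existsThree_iff : ExistsThree S ↔ ExistsTwo S ∧ ZThree S :=
  ⟨fun h => ⟨h.existsTwo, h.zThree⟩, fun h => h.1.existsThree h.2⟩

/-! ### Truth of the sentences -/

theorem sat_existsTwo : Sat existsTwo (Env.nil (S := S)) ↔ ExistsTwo S := by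
  simp only [existsTwo, sat_ex, sat_and, sat_all, sat_iff, sat_le, sat_eq, eval_app, eval_var,
    eval_zero, eval_one, Env.cons_here, Env.cons_there]
  rfl

theorem sat_existsThree : Sat existsThree (Env.nil (S := S)) ↔ ExistsThree S := by
  simp only [existsThree, sat_ex, sat_and, sat_all, sat_iff, sat_le, sat_eq, eval_app, eval_var,
    eval_zero, eval_one, Env.cons_here, Env.cons_there]
  rfl

theorem sat_inCantor {Γ : Ctx} {f : Term Γ T1} {e : S.Env Γ} :
    Sat (inCantor f) e ↔ InCantor (eval e f) := by
  simp only [inCantor, sat_all, sat_le, eval_app, eval_wk, eval_var, eval_one, Env.cons_here]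
  rfl

theorem sat_agree {Γ : Ctx} {f g : Term Γ T1} {N : Term Γ .nat} {e : S.Env Γ} :
    Sat (agree f g N) e ↔ ∀ i < eval e N, eval e f i = eval e g i := by
  simp only [agree, sat_all, sat_imp, sat_lt, sat_eq, eval_app, eval_wk, eval_var, Env.cons_here]

theorem sat_isCont {Γ : Ctx} {Y : Term Γ T2} {e : S.Env Γ} :
    Sat (isCont Y) e ↔ Cont (eval e Y) := by
  simp only [isCont, sat_all, sat_ex, sat_imp, sat_agree, sat_eq, eval_app, eval_wk, eval_var,
    Env.cons_here, Env.cons_there]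
  rfl

theorem sat_kappaZero : Sat kappaZero (Env.nil (S := S)) ↔ KappaZero S := by
  simp only [kappaZero, sat_ex, sat_and, sat_all, sat_iff, sat_lt, sat_eq, sat_inCantor, eval_app,
    eval_var, eval_zero, Env.cons_here, Env.cons_there]
  rfl

theorem sat_zThree : Sat zThree (Env.nil (S := S)) ↔ ZThree S := by
  simp only [zThree, sat_ex, sat_all, sat_iff, sat_eq, sat_isCont, eval_app, eval_var, eval_zero,
    Env.cons_here, Env.cons_there]
  rfl

theorem sat_fanFunctional : Sat fanFunctional (Env.nil (S := S)) ↔ FanFunctional S := by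
  simp only [fanFunctional, sat_ex, sat_all, sat_imp, sat_eq, sat_isCont, sat_inCantor, sat_agree,
    eval_app, eval_var, Env.cons_here, Env.cons_there]
  rfl

theorem sat_weakKonig : Sat weakKonig (Env.nil (S := S)) ↔ WeakKonig S := by
  simp only [weakKonig, isTree, isInfinite, codesInitial, snoc, sat_ex, sat_and, sat_all, sat_imp,
    sat_le, sat_lt, sat_eq, sat_inCantor, eval_app, eval_wk, eval_var, eval_add, eval_zero,
    eval_one, Env.cons_here, Env.cons_there]
  rfl

end Struc

end HOA

theorem mainTheorem8 :
    HOA.Proves (HOA.RCA0w ∪ HOA.QFAC HOA.T2 HOA.Ty.nat)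
      ((HOA.kappaZero ∧ₒ HOA.weakKonig) ↔ₒ (HOA.zThree ∧ₒ HOA.fanFunctional)) ∧
    HOA.Proves HOA.RCA0w
      (HOA.existsThree ↔ₒ (HOA.existsTwo ∧ₒ HOA.zThree)) := by
  constructor
  · refine HOA.proves_of_isModel Set.subset_union_left fun S _ hT => ?_
    simp only [HOA.Struc.sat_iff, HOA.Struc.sat_and, HOA.Struc.sat_kappaZero,
      HOA.Struc.sat_weakKonig, HOA.Struc.sat_zThree, HOA.Struc.sat_fanFunctional]
    exact HOA.Struc.kappaZero_and_weakKonig_iff fun A hA => hT A (.inr hA)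
  · refine HOA.proves_of_isModel subset_rfl fun S _ _ => ?_
    simp only [HOA.Struc.sat_iff, HOA.Struc.sat_and, HOA.Struc.sat_existsThree,
      HOA.Struc.sat_existsTwo, HOA.Struc.sat_zThree]
    exact HOA.Struc.existsThree_iff
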